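/- Fix the finite alphabet $\Sigma=\{0,1,\mathsf{T},\mathsf{F},x,\neg,\wedge,\vee\}$. Propositional Boolean formulas are built from the constants True and False and the variables $x_w$ ($w\in\{0,1\}^*$) with $\neg,\wedge,\vee$, and are written as strings over $\Sigma$ in Polish (prefix) notation, the variable $x_w$ being written as $x$ followed by the binary word $w$. Let $\mathrm{SAT}\subseteq\Sigma^*$ be the set of (strings representing) satisfiable formulas. A set $T\subseteq\Sigma^*$ is a tally set if $T\subseteq\{\epsilon,0,00,000,\dots\}$. For $A,B\subseteq\Sigma^*$ write $A\le_m^p B$ ($A$ many-one polynomial-time reduces to $B$) if there is a polynomial-time computable function $g:\Sigma^*\to\Sigma^*$ such that $s\in A\iff g(s)\in B$ for all $s\in\Sigma^*$. Let $\mathrm{P}$ be the class of sets $A\subseteq\Sigma^*$ whose membership is decided by a polynomial-time algorithm. Polynomial time means: on a deterministic (multi-stack) Turing machine, in a number of steps bounded by a polynomial in the length of the input. **Theorem (Berman).** If there exists a tally set $T$ such that $\mathrm{SAT}\le_m^p T$, then $\mathrm{SAT}\in\mathrm{P}$. -/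

import Mathlib

namespace PropSAT

/-- Propositional Boolean formulas over the variables `x_w`, one for each binary word `w`,
with the constants True and False. -/
inductive Formula where
  | verum : Formula
  | falsum : Formula
  | var (w : List Bool) : Formula
  | neg (F : Formula) : Formula
  | conj (F G : Formula) : Formula
  | disj (F G : Formula) : Formula

/-- The truth value of a formula under an assignment of truth values to the variables. -/
def Formula.eval (v : List Bool → Bool) : Formula → Bool
  | .verum => true
  | .falsum => false
  | .var w => v w
  | .neg F => !(F.eval v)
  | .conj F G => F.eval v && G.eval v
  | .disj F G => F.eval v || G.eval v

/-- A formula is satisfiable if some assignment makes it evaluate to True. -/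
def Formula.Satisfiable (F : Formula) : Prop :=
  ∃ v : List Bool → Bool, F.eval v = true

/-- The finite alphabet `Σ`: the two binary digits `0` and `1`, the constants True and False,
the letter `x` that starts the name of a variable, and the three connectives. -/
inductive Letter where
  | zero : Letter
  | one : Letter
  | verum : Letter
  | falsum : Letter
  | x : Letter
  | neg : Letter
  | conj : Letter
  | disj : Letter
  deriving DecidableEq

instance : Fintype Letter where
  elems := {.zero, .one, .verum, .falsum, .x, .neg, .conj, .disj}
  complete a := by cases a <;> simp

/-- The letter of a binary digit. -/
def Letter.ofBit (b : Bool) : Letter :=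
  if b then .one else .zero

/-- The string that represents a formula, in Polish (prefix) notation; the variable `x_w` is
written as the letter `x` followed by the binary word `w`. -/
def Formula.encode : Formula → List Letter
  | .verum => [.verum]
  | .falsum => [.falsum]
  | .var w => .x :: w.map Letter.ofBit
  | .neg F => .neg :: F.encode
  | .conj F G => .conj :: (F.encode ++ G.encode)
  | .disj F G => .disj :: (F.encode ++ G.encode)

/-- The language SAT: the strings that represent satisfiable formulas. -/
def SAT : Language Letter :=
  {s | ∃ F : Formula, F.encode = s ∧ F.Satisfiable}

/-- A tally set: a set of strings all of whose letters are `0`. -/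
def IsTally (T : Language Letter) : Prop :=
  ∀ s ∈ T, ∃ n : ℕ, s = List.replicate n Letter.zero

/-- A total function on strings is polynomial-time computable if a Turing machine (with finitely
many stacks in place of tapes) computes it in a number of steps that is bounded by a polynomial in
the length of the input. -/
def PolyTimeComputable {A B : Type} (g : List A → List B) : Prop :=
  Nonempty (Turing.TM2ComputableInPolyTime id id g)

/-- Many-one polynomial-time reducibility between languages. -/
def PolyTimeReduces {A B : Type} (K : Language A) (L : Language B) : Prop :=
  ∃ g : List A → List B, PolyTimeComputable g ∧ ∀ s : List A, s ∈ K ↔ g s ∈ L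

/-- The class P of the languages over a given alphabet whose membership is decided by a
polynomial-time Turing machine, which outputs a single bit. -/
def P (A : Type) : Set (Language A) :=
  {L | ∃ f : List A → Bool,
    Nonempty (Turing.TM2ComputableInPolyTime id Computability.encodeBool f) ∧
      ∀ s : List A, s ∈ L ↔ f s = true}

/-- Unique readability, with trailing text: a parse is determined up to a rest that does not
start with a digit. -/
theorem Formula.encode_append_inj (F : Formula) :
    ∀ (G : Formula) (s t : List Letter), (∀ b, s.head? ≠ some (Letter.ofBit b)) →
      (∀ b, t.head? ≠ some (Letter.ofBit b)) → F.encode ++ s = G.encode ++ t → F = G ∧ s = t := by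
  have hd : ∀ (H : Formula) (r : List Letter) (b : Bool),
      (H.encode ++ r).head? ≠ some (Letter.ofBit b) := by
    intro H r b; cases H <;> cases b <;> simp [Formula.encode, Letter.ofBit]
  have hw : ∀ (u w : List Bool) (s t : List Letter), (∀ b, s.head? ≠ some (Letter.ofBit b)) →
      (∀ b, t.head? ≠ some (Letter.ofBit b)) →
      u.map Letter.ofBit ++ s = w.map Letter.ofBit ++ t → u = w ∧ s = t := by
    intro u
    induction u with
    | nil =>
      intro w s t hs ht h
      cases w with
      | nil => simpa using h
      | cons c w => exact absurd (by simp at h; simp [h]) (hs c)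
    | cons b u ih =>
      intro w s t hs ht h
      cases w with
      | nil => exact absurd (by simp at h; simp [← h]) (ht b)
      | cons c w =>
        simp only [List.map_cons, List.cons_append, List.cons.injEq] at h
        obtain ⟨h1, h2⟩ := ih w s t hs ht h.2
        refine ⟨?_, h2⟩
        have : b = c := by
          revert h; cases b <;> cases c <;> simp [Letter.ofBit]
        rw [this, h1]
  induction F with
  | verum | falsum =>
    intro G s t hs ht h
    cases G <;> simp only [Formula.encode, List.cons_append, List.nil_append, List.cons.injEq,
      reduceCtorEq, false_and, true_and] at h
    exact ⟨rfl, h⟩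
  | var w =>
    intro G s t hs ht h
    cases G <;> simp only [Formula.encode, List.cons_append, List.cons.injEq, reduceCtorEq,
      false_and, true_and] at h
    obtain ⟨h1, h2⟩ := hw _ _ _ _ hs ht h
    exact ⟨by rw [h1], h2⟩
  | neg F ih =>
    intro G s t hs ht h
    cases G <;> simp only [Formula.encode, List.cons_append, List.cons.injEq, reduceCtorEq,
      false_and, true_and] at h
    obtain ⟨h1, h2⟩ := ih _ _ _ hs ht h
    exact ⟨by rw [h1], h2⟩
  | conj F₁ F₂ ih₁ ih₂ | disj F₁ F₂ ih₁ ih₂ =>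
    intro G s t hs ht h
    cases G <;> simp only [Formula.encode, List.cons_append, List.append_assoc, List.cons.injEq,
      reduceCtorEq, false_and, true_and] at h
    obtain ⟨h1, h2⟩ := ih₁ _ _ _ (hd _ _) (hd _ _) h
    obtain ⟨h3, h4⟩ := ih₂ _ _ _ hs ht h2
    exact ⟨by rw [h1, h3], h4⟩

/-- Distinct formulas are represented by distinct strings. -/
theorem Formula.encode_injective : Function.Injective Formula.encode := by
  intro F G h
  exact (Formula.encode_append_inj F G [] [] (by simp) (by simp) (by simpa using h)).1

end PropSAT

open Turing StateTransition Function

/-! ### A structured programming language over stacks -/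

/-! SAT is self-reducible: a formula is satisfiable iff one of its two instances, with some variable
set to True or False, is (`mem_SAT_iff_substLast`). Expanding a list of formulas in this way round
by round ends in variable-free formulas, but the list would double each time. The reduction `g` to
the tally set prunes it. A formula whose image is not a string of zeros is unsatisfiable and can be
dropped; two formulas with the same string of zeros as image are both satisfiable or both not, so
one of them suffices (`exists_mem_consider`). A string of zeros is determined by its length, and a
polynomial-time `g` has polynomially long outputs (`Turing.FinTM2.exists_length_output_le`), so at
most polynomially many formulas survive (`IsTable.length_snd_le`). Each round removes a variable
occurrence from every formula that has one. Hence after as many rounds as the input has letters only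
closed formulas are left, and evaluating them settles the question (`iterate_round_spec`,
`exec_satCmd`).

The rest makes this a Turing machine. The procedure is written in a small stack language with a
big-step cost semantics and a call instruction for the machine of `g`; `reachIn_of_runs` shows that
compiled code respects the semantics step for step, and `computable_of_runs` wraps it into a
decision machine.

All string operations are defined on arbitrary strings, well formed or not, so the program never
parses: strings are read from right to left and evaluated on a stack of truth values. -/

/-- Programs over stacks indexed by `K` with letters in `B`: pushing, popping with a case
distinction on the popped letter, loops that pop a stack until it is empty, and calls of an external
function that is applied to the reversal of stack `i` and whose reversed value is put on
stack `j`. -/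
inductive Cmd (K B : Type) where
  | skip : Cmd K B
  | push (k : K) (b : B) : Cmd K B
  | seq (c d : Cmd K B) : Cmd K B
  | pop (k : K) (f : Option B → Cmd K B) : Cmd K B
  | loop (k : K) (f : B → Cmd K B) : Cmd K B
  | call (i j : K) : Cmd K B

namespace Cmd

infixr:60 " ;; " => Cmd.seq

section

variable {K B : Type}

/-- The program points of a program, where the external machine has program points `Λ`. -/
def Lbl (Λ : Type) : Cmd K B → Type
  | .skip => Unit
  | .push _ _ => Unit
  | .seq c d => c.Lbl Λ ⊕ d.Lbl Λ
  | .pop _ f => Option (Σ b : Option B, (f b).Lbl Λ)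
  | .loop _ f => Option (Σ b : B, (f b).Lbl Λ)
  | .call _ _ => Bool ⊕ Λ

theorem finite_lbl (Λ : Type) [Finite Λ] [Finite B] (c : Cmd K B) : Finite (c.Lbl Λ) := by
  induction c with
  | skip | push => exact inferInstanceAs (Finite Unit)
  | seq c d hc hd => exact inferInstanceAs (Finite (c.Lbl Λ ⊕ d.Lbl Λ))
  | pop k f h => exact inferInstanceAs (Finite (Option (Σ b : Option B, (f b).Lbl Λ)))
  | loop k f h => exact inferInstanceAs (Finite (Option (Σ b : B, (f b).Lbl Λ)))
  | call => exact inferInstanceAs (Finite (Bool ⊕ Λ))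

/-- The program point at which a program starts. -/
def entry (Λ : Type) : (c : Cmd K B) → c.Lbl Λ
  | .skip => ()
  | .push _ _ => ()
  | .seq c _ => Sum.inl (c.entry Λ)
  | .pop _ _ => none
  | .loop _ _ => none
  | .call _ _ => Sum.inl true

end

/-- `Runs g t c S S' n`: the program `c` transforms the stacks `S` into `S'` at a cost of at
most `n`, where the external function `g` costs `t`. -/
inductive Runs {K B : Type} [DecidableEq K] (g : List B → List B) (t : List B → ℕ) :
    Cmd K B → (K → List B) → (K → List B) → ℕ → Prop
  | skip S : Runs g t .skip S S 1
  | push k b S : Runs g t (.push k b) S (update S k (b :: S k)) 1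
  | seq {c d S₁ S₂ S₃ m n} : Runs g t c S₁ S₂ m → Runs g t d S₂ S₃ n →
      Runs g t (.seq c d) S₁ S₃ (m + n)
  | pop {k f S S' n} : Runs g t (f (S k).head?) (update S k (S k).tail) S' n →
      Runs g t (.pop k f) S S' (1 + n)
  | loop_nil {k f S} : S k = [] → Runs g t (.loop k f) S S 1
  | loop_cons {k f S S₁ S₂ b l m n} : S k = b :: l → Runs g t (f b) (update S k l) S₁ m →
      Runs g t (.loop k f) S₁ S₂ n → Runs g t (.loop k f) S S₂ (1 + m + n)
  | call i j S : Runs g t (.call i j) S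
      (update (update S i []) j ((g (S i).reverse).reverse ++ update S i [] j))
      (t (S i).reverse + (S i).length + (g (S i).reverse).length + 2)
  | weaken {c S S' m n} : Runs g t c S S' m → m ≤ n → Runs g t c S S' n

end Cmd

/-! ### Compilation to multi-stack Turing machines -/

/-- `f` reaches `b` from `a` in at most `n` steps. -/
def ReachIn {σ : Type*} (f : σ → Option σ) (n : ℕ) (a b : σ) : Prop :=
  ∃ m ≤ n, (flip bind f)^[m] (some a) = some b

namespace ReachIn

variable {σ : Type*} {f : σ → Option σ} {a b c : σ} {m n : ℕ}

theorem mono (h : ReachIn f m a b) (hmn : m ≤ n) : ReachIn f n a b :=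
  let ⟨k, hk, e⟩ := h
  ⟨k, hk.trans hmn, e⟩

theorem trans (h₁ : ReachIn f m a b) (h₂ : ReachIn f n b c) : ReachIn f (m + n) a c := by
  obtain ⟨k, hk, e⟩ := h₁
  obtain ⟨l, hl, e'⟩ := h₂
  exact ⟨l + k, by omega, by rw [iterate_add_apply, e, e']⟩

theorem single (h : f a = some b) : ReachIn f 1 a b := ⟨1, le_rfl, h⟩

theorem step {K Λ τ : Type} [DecidableEq K] {Γ : K → Type} {M : Λ → TM2.Stmt Γ Λ τ} {l : Λ} {v : τ}
    {S : ∀ k, List (Γ k)} {b : TM2.Cfg Γ Λ τ} (h : TM2.stepAux (M l) v S = b) :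
    ReachIn (TM2.step M) 1 ⟨some l, v, S⟩ b :=
  single (congrArg some h)

end ReachIn

namespace Cmd

section Compile

variable {K B A : Type} [DecidableEq K] (tm : FinTM2)

/-- The stack alphabets of a compiled program: its own stacks, those of the external machine, and an
input stack and an output stack. -/
abbrev Alph (K B A : Type) (tm : FinTM2) : K ⊕ tm.K ⊕ Bool → Type
  | .inl _ => B
  | .inr (.inl k) => tm.Γ k
  | .inr (.inr true) => A
  | .inr (.inr false) => Bool

/-- Stack contents of a compiled program, put together from the different kinds of stacks. -/
def glue (R : K → List B) (E : ∀ k, List (tm.Γ k)) (a : List A) (o : List Bool) :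
    ∀ k, List (Alph K B A tm k)
  | .inl k => R k
  | .inr (.inl k) => E k
  | .inr (.inr true) => a
  | .inr (.inr false) => o

variable {tm}

theorem update_glue_inl (R : K → List B) (E : ∀ k, List (tm.Γ k)) (a : List A) (o : List Bool)
    (k : K) (l : List B) :
    update (glue tm R E a o) (.inl k) l = glue tm (update R k l) E a o := by
  refine update_eq_iff.2 ⟨(update_self k l R).symm, fun x hx => ?_⟩
  rcases x with x | x | _ | _
  · exact (update_of_ne (fun h => hx (congrArg _ h)) l R).symm
  all_goals rfl

theorem update_glue_inr (R : K → List B) (E : ∀ k, List (tm.Γ k)) (a : List A) (o : List Bool)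
    (k : tm.K) (l : List (tm.Γ k)) :
    update (glue tm R E a o) (.inr (.inl k)) l = glue tm R (update E k l) a o := by
  refine update_eq_iff.2 ⟨(update_self k l E).symm, fun x hx => ?_⟩
  rcases x with x | x | _ | _
  · rfl
  · exact (update_of_ne (fun h : x = k => hx (by rw [h])) l E).symm
  all_goals rfl

theorem update_glue_input (R : K → List B) (E : ∀ k, List (tm.Γ k)) (a l : List A)
    (o : List Bool) :
    update (glue tm R E a o) (.inr (.inr true)) l = glue tm R E l o := by
  refine update_eq_iff.2 ⟨rfl, fun x hx => ?_⟩
  rcases x with x | x | _ | _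
  iterate 3 rfl
  exact absurd rfl hx

theorem update_glue_output (R : K → List B) (E : ∀ k, List (tm.Γ k)) (a : List A)
    (o l : List Bool) :
    update (glue tm R E a o) (.inr (.inr false)) l = glue tm R E a l := by
  refine update_eq_iff.2 ⟨rfl, fun x hx => ?_⟩
  rcases x with x | x | _ | _
  iterate 2 rfl
  · exact absurd rfl hx
  · rfl

section StepAux

variable {Λ σ : Type} (q : TM2.Stmt (Alph K B A tm) Λ σ) (s : σ) (R : K → List B)
  (E : ∀ k, List (tm.Γ k)) (a : List A) (o : List Bool)

theorem stepAux_push_inl (k : K) (f : σ → B) :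
    TM2.stepAux (.push (Γ := Alph K B A tm) (.inl k) f q) s (glue tm R E a o) =
      TM2.stepAux q s (glue tm (update R k (f s :: R k)) E a o) :=
  congrArg (TM2.stepAux q s) (update_glue_inl R E a o k _)

theorem stepAux_pop_inl (k : K) (f : σ → Option B → σ) :
    TM2.stepAux (.pop (Γ := Alph K B A tm) (.inl k) f q) s (glue tm R E a o) =
      TM2.stepAux q (f s (R k).head?) (glue tm (update R k (R k).tail) E a o) :=
  congrArg (TM2.stepAux q _) (update_glue_inl R E a o k _)

theorem stepAux_push_inr (k : tm.K) (f : σ → tm.Γ k) :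
    TM2.stepAux (.push (Γ := Alph K B A tm) (.inr (.inl k)) f q) s (glue tm R E a o) =
      TM2.stepAux q s (glue tm R (update E k (f s :: E k)) a o) :=
  congrArg (TM2.stepAux q s) (update_glue_inr R E a o k _)

theorem stepAux_pop_inr (k : tm.K) (f : σ → Option (tm.Γ k) → σ) :
    TM2.stepAux (.pop (Γ := Alph K B A tm) (.inr (.inl k)) f q) s (glue tm R E a o) =
      TM2.stepAux q (f s (E k).head?) (glue tm R (update E k (E k).tail) a o) :=
  congrArg (TM2.stepAux q _) (update_glue_inr R E a o k _)

theorem stepAux_pop_input (f : σ → Option A → σ) :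
    TM2.stepAux (.pop (Γ := Alph K B A tm) (.inr (.inr true)) f q) s (glue tm R E a o) =
      TM2.stepAux q (f s a.head?) (glue tm R E a.tail o) :=
  congrArg (TM2.stepAux q _) (update_glue_input R E a _ o)

theorem stepAux_push_output (f : σ → Bool) :
    TM2.stepAux (.push (Γ := Alph K B A tm) (.inr (.inr false)) f q) s (glue tm R E a o) =
      TM2.stepAux q s (glue tm R E a (f s :: o)) :=
  congrArg (TM2.stepAux q s) (update_glue_output R E a o _)

end StepAux

/-! ### Simulation of the external machine -/

/-- A statement of the external machine as a statement of the compiled program. -/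
def liftStmt {Λ : Type} (ι : tm.Λ → Λ) (ret : Λ) :
    TM2.Stmt tm.Γ tm.Λ tm.σ → TM2.Stmt (Alph K B A tm) Λ (tm.σ × Option B)
  | .push k f q => .push (.inr (.inl k)) (fun s => f s.1) (liftStmt ι ret q)
  | .peek k f q => .peek (.inr (.inl k)) (fun s o => (f s.1 o, s.2)) (liftStmt ι ret q)
  | .pop k f q => .pop (.inr (.inl k)) (fun s o => (f s.1 o, s.2)) (liftStmt ι ret q)
  | .load f q => .load (fun s => (f s.1, s.2)) (liftStmt ι ret q)
  | .branch f q r => .branch (fun s => f s.1) (liftStmt ι ret q) (liftStmt ι ret r)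
  | .goto f => .goto (fun s => ι (f s.1))
  | .halt => .goto (fun _ => ret)

/-- A configuration of the external machine as a configuration of the compiled program. -/
def liftCfg {Λ : Type} (ι : tm.Λ → Λ) (ret : Λ) (R : K → List B) (a : List A) (o : List Bool)
    (v : Option B) (c : TM2.Cfg tm.Γ tm.Λ tm.σ) :
    TM2.Cfg (Alph K B A tm) Λ (tm.σ × Option B) :=
  ⟨some (c.l.elim ret ι), (c.var, v), glue tm R c.stk a o⟩

theorem stepAux_liftStmt {Λ : Type} (ι : tm.Λ → Λ) (ret : Λ) (R : K → List B) (a : List A)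
    (o : List Bool) (v : Option B) (q : TM2.Stmt tm.Γ tm.Λ tm.σ) :
    ∀ (s : tm.σ) (E : ∀ k, List (tm.Γ k)),
      TM2.stepAux (liftStmt ι ret q) (s, v) (glue tm R E a o) =
        liftCfg ι ret R a o v (TM2.stepAux q s E) := by
  induction q with
  | push k f q ih =>
    intro s E
    exact (stepAux_push_inr _ (s, v) R E a o k fun s => f s.1).trans (ih _ _)
  | peek k f q ih => intro s E; exact ih _ _
  | pop k f q ih =>
    intro s E
    exact (stepAux_pop_inr _ (s, v) R E a o k fun s x => (f s.1 x, s.2)).trans (ih _ _)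
  | load f q ih => intro s E; exact ih _ _
  | branch f q r ihq ihr =>
    intro s E
    simp only [liftStmt, TM2.stepAux]
    cases f s
    · exact ihr _ _
    · exact ihq _ _
  | goto f => intro s E; rfl
  | halt => intro s E; rfl

/-- Step counts agree exactly: halting is turned into a jump to `ret` within the same step, and no
step is defined from a halted configuration, so a run that reaches `d` never passes through one
earlier. -/
theorem reachIn_liftCfg {Λ : Type} {M : Λ → TM2.Stmt (Alph K B A tm) Λ (tm.σ × Option B)}
    {ι : tm.Λ → Λ} {ret : Λ} (hM : ∀ l, M (ι l) = liftStmt ι ret (tm.m l))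
    (R : K → List B) (a : List A) (o : List Bool) (v : Option B) {n : ℕ} {c d : tm.Cfg}
    (h : (flip bind tm.step)^[n] (some c) = some d) :
    (flip bind (TM2.step M))^[n] (some (liftCfg ι ret R a o v c)) =
      some (liftCfg ι ret R a o v d) := by
  induction n generalizing d with
  | zero => cases h; rfl
  | succ n ih =>
    rw [iterate_succ_apply'] at h ⊢
    obtain ⟨e, he, hd⟩ := Option.bind_eq_some_iff.1 h
    rw [ih he]
    rcases e with ⟨_ | l, s, E⟩
    · cases hd
    · cases hd
      refine Eq.trans (congrArg (fun q => some (TM2.stepAux q (s, v) (glue tm R E a o))) (hM l)) ?_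
      exact congrArg some (stepAux_liftStmt ι ret R a o v _ _ _)

/-- The statements of the machine that executes a program and then jumps to `ret`. -/
def code [Inhabited B] (enc : B → tm.Γ tm.k₀) (dec : tm.Γ tm.k₁ → B) {Λ : Type} :
    (c : Cmd K B) → (c.Lbl tm.Λ → Λ) → Λ → c.Lbl tm.Λ →
      TM2.Stmt (Alph K B A tm) Λ (tm.σ × Option B)
  | .skip, _, ret => fun _ => .goto fun _ => ret
  | .push k b, _, ret => fun _ => .push (.inl k) (fun _ => b) (.goto fun _ => ret)
  | .seq c d, ι, ret =>
    Sum.elim (c.code enc dec (fun l => ι (.inl l)) (ι (.inr (d.entry tm.Λ))))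
      (d.code enc dec (fun l => ι (.inr l)) ret)
  | .pop k f, ι, ret => fun
    | none => .pop (.inl k) (fun s o => (s.1, o))
        (.goto fun s => ι (some ⟨s.2, (f s.2).entry tm.Λ⟩))
    | some ⟨b, l⟩ => (f b).code enc dec (fun l => ι (some ⟨b, l⟩)) ret l
  | .loop k f, ι, ret => fun
    | none => .pop (.inl k) (fun s o => (s.1, o))
        (.goto fun s => s.2.elim ret fun b => ι (some ⟨b, (f b).entry tm.Λ⟩))
    | some ⟨b, l⟩ => (f b).code enc dec (fun l => ι (some ⟨b, l⟩)) (ι none) l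
  | .call i j, ι, ret => fun
    | .inl true => .pop (.inl i) (fun s o => (s.1, o)) (.branch (fun s => s.2.isSome)
        (.push (.inr (.inl tm.k₀)) (fun s => enc (s.2.getD default))
          (.goto fun _ => ι (.inl true)))
        (.goto fun _ => ι (.inr tm.main)))
    | .inl false => .pop (.inr (.inl tm.k₁)) (fun s o => (s.1, o.map dec))
        (.branch (fun s => s.2.isSome)
          (.push (.inl j) (fun s => s.2.getD default) (.goto fun _ => ι (.inl false)))
          (.goto fun _ => ret))
    | .inr l => liftStmt (fun l => ι (.inr l)) (ι (.inl false)) (tm.m l)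

/-! ### Compiled code and the big-step semantics -/

section Reach

variable [Inhabited B] {enc : B → tm.Γ tm.k₀} {dec : tm.Γ tm.k₁ → B} {Λ : Type}
  {M : Λ → TM2.Stmt (Alph K B A tm) Λ (tm.σ × Option B)} (a : List A) (o : List Bool)

/-- A statement performs pop, test and push in a single machine step, so the transfer costs one step
per symbol and one more to notice the empty stack. Popping and pushing reverses the word, whence the
reversals in the semantics of `Cmd.call`. -/
theorem reachIn_feed {i j : K} {ι : (Cmd.call i j : Cmd K B).Lbl tm.Λ → Λ} {ret : Λ}
    (hM : ∀ l, M (ι l) = (Cmd.call i j : Cmd K B).code enc dec ι ret l)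
    (s : tm.σ) (l : List B) :
    ∀ (R : K → List B) (E : ∀ k, List (tm.Γ k)) (v : Option B), R i = l →
      ReachIn (TM2.step M) (l.length + 1)
        ⟨some (ι (.inl true)), (s, v), glue tm R E a o⟩
        ⟨some (ι (.inr tm.main)), (s, none),
          glue tm (update R i []) (update E tm.k₀ (l.reverse.map enc ++ E tm.k₀)) a o⟩ := by
  have hM' := hM (.inl true)
  induction l with
  | nil =>
    intro R E v h
    refine ReachIn.step ?_
    simp only [hM', code, stepAux_pop_inl, TM2.stepAux.eq_5, TM2.stepAux.eq_6]
    simp [h]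
  | cons b l ih =>
    intro R E v h
    have h' := ih (update R i l) (update E tm.k₀ (enc b :: E tm.k₀)) (some b) (by simp)
    simp only [update_idem, update_self, List.map_reverse] at h'
    simp only [List.reverse_cons, List.map_append, List.map_reverse, List.append_assoc,
      List.length_cons, List.map_cons, List.map_nil, List.cons_append, List.nil_append]
    refine ((ReachIn.step ?_).trans h').mono (by omega)
    simp only [hM', code, stepAux_pop_inl, stepAux_push_inr, TM2.stepAux.eq_5, TM2.stepAux.eq_6]
    simp [h]

theorem reachIn_drain {i j : K} {ι : (Cmd.call i j : Cmd K B).Lbl tm.Λ → Λ} {ret : Λ}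
    (hM : ∀ l, M (ι l) = (Cmd.call i j : Cmd K B).code enc dec ι ret l)
    (s : tm.σ) (l : List (tm.Γ tm.k₁)) :
    ∀ (R : K → List B) (E : ∀ k, List (tm.Γ k)) (v : Option B), E tm.k₁ = l →
      ReachIn (TM2.step M) (l.length + 1)
        ⟨some (ι (.inl false)), (s, v), glue tm R E a o⟩
        ⟨some ret, (s, none),
          glue tm (update R j ((l.map dec).reverse ++ R j)) (update E tm.k₁ []) a o⟩ := by
  have hM' := hM (.inl false)
  induction l with
  | nil =>
    intro R E v h
    refine ReachIn.step ?_
    simp only [hM', code, stepAux_pop_inr, TM2.stepAux.eq_5, TM2.stepAux.eq_6]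
    simp [h]
  | cons b l ih =>
    intro R E v h
    have h' := ih (update R j (dec b :: R j)) (update E tm.k₁ l) (some (dec b)) (by simp)
    simp only [update_idem, update_self] at h'
    simp only [List.reverse_cons, List.append_assoc, List.length_cons, List.map_cons,
      List.cons_append, List.nil_append]
    refine ((ReachIn.step ?_).trans h').mono (by omega)
    simp only [hM', code, stepAux_pop_inr, stepAux_push_inl, TM2.stepAux.eq_5, TM2.stepAux.eq_6]
    simp [h]

/-- The compiled program follows the big-step semantics. -/
theorem reachIn_of_runs {g : List B → List B} {t : List B → ℕ}
    (hg : ∀ l, ∃ out : List (tm.Γ tm.k₁), out.map dec = g l ∧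
      Nonempty (TM2OutputsInTime tm (l.map enc) (some out) (t l)))
    {c : Cmd K B} {R R' : K → List B} {n : ℕ} (h : Runs g t c R R' n) :
    ∀ {ι : c.Lbl tm.Λ → Λ} {ret : Λ}, (∀ l, M (ι l) = c.code enc dec ι ret l) →
      ∀ v : Option B, ∃ v', ReachIn (TM2.step M) n
        ⟨some (ι (c.entry tm.Λ)), (tm.initialState, v), glue tm R (fun _ => []) a o⟩
        ⟨some ret, (tm.initialState, v'), glue tm R' (fun _ => []) a o⟩ := by
  induction h with
  | skip S =>
    intro ι ret hM v
    have hM' := hM ()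
    exact ⟨v, ReachIn.step ((by simp [hM', entry, code]))⟩
  | push k b S =>
    intro ι ret hM v
    have hM' := hM ()
    exact ⟨v, ReachIn.step ((by
      simp only [hM', entry, code, stepAux_push_inl, TM2.stepAux.eq_6]))⟩
  | seq _ _ ihc ihd =>
    intro ι ret hM v
    obtain ⟨v', h₁⟩ := ihc (fun l => hM (.inl l)) v
    obtain ⟨v'', h₂⟩ := ihd (fun l => hM (.inr l)) v'
    exact ⟨v'', h₁.trans h₂⟩
  | @pop k f S S' n _ ih =>
    intro ι ret hM v
    have hM' := hM none
    obtain ⟨v', h⟩ := ih (ι := fun l => ι (some ⟨_, l⟩)) (ret := ret)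
      (fun l => (hM (some ⟨_, l⟩)).trans (by simp only [code])) (S k).head?
    refine ⟨v', (ReachIn.step ?_).trans h⟩
    simp only [hM', entry, code, stepAux_pop_inl, TM2.stepAux.eq_6]
  | @loop_nil k f S h =>
    intro ι ret hM v
    have hM' := hM none
    refine ⟨none, ReachIn.step ?_⟩
    have : update S k [] = S := by rw [← h]; simp
    simp only [hM', entry, code, stepAux_pop_inl, TM2.stepAux.eq_6]
    simp [h, this]
  | @loop_cons k f S S₁ S₂ b l m n h _ _ ih₁ ih₂ =>
    intro ι ret hM v
    have hM' := hM none
    -- The loop body returns to the loop head `ι none`.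
    obtain ⟨v₁, h₁⟩ := ih₁ (ι := fun l => ι (some ⟨_, l⟩)) (ret := ι none)
      (fun l => (hM (some ⟨_, l⟩)).trans (by simp only [code])) (some b)
    obtain ⟨v₂, h₂⟩ := ih₂ hM v₁
    refine ⟨v₂, ((ReachIn.step ?_).trans h₁).trans h₂⟩
    simp only [hM', entry, code, stepAux_pop_inl, TM2.stepAux.eq_6]
    simp [h]
  | call i j S =>
    intro ι ret hM v
    obtain ⟨out, hout, ⟨e⟩⟩ := hg (S i).reverse
    have h₁ := reachIn_feed a o hM tm.initialState (S i) S (fun _ => []) v rfl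
    have h₂ := reachIn_liftCfg (fun l => hM (.inr l)) (update S i []) a o none e.evals_in_steps
    have h₃ := reachIn_drain a o hM tm.initialState out (update S i [])
      (update (fun _ => []) tm.k₁ out) none (by simp)
    have hin : glue tm (update S i []) (update (fun _ => []) tm.k₀ ((S i).reverse.map enc ++ []))
        a o = glue tm (update S i []) (initList tm ((S i).reverse.map enc)).stk a o := by
      congr 1
      refine update_eq_iff.2 ⟨by simp [initList], fun k hk => by simp [initList, hk]⟩
    -- The external machine halts in its initial internal state with nothing but the output on its
    -- stacks. Once the output is drained it is as good as new, which is what allows repeated calls.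
    have hout' : (haltList tm out).stk = update (fun _ => []) tm.k₁ out := by
      refine (update_eq_iff.2 ⟨by simp [haltList], fun k hk => by simp [haltList, hk]⟩).symm
    rw [hin] at h₁
    have h := h₁.trans (ReachIn.trans ⟨e.steps, e.steps_le_m, h₂⟩ (by
      simp only [liftCfg, hout']; exact h₃))
    have hl : out.length = (g (S i).reverse).length := by rw [← hout, List.length_map]
    refine ⟨none, ?_⟩
    rw [update_idem, update_eq_self_iff.2 rfl, hout] at h
    exact h.mono (by omega)
  | weaken _ hmn ih =>
    intro ι ret hM v
    obtain ⟨v', h⟩ := ih hM v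
    exact ⟨v', h.mono hmn⟩

end Reach

/-! ### The complete machine: input, program, output -/

section Main

variable [Inhabited B] (enc : B → tm.Γ tm.k₀)
  (dec : tm.Γ tm.k₁ → B) (emb : A → B) (r o : K) (c : Cmd K B)

/-- The statements of the machine that copies the input, reversed, to stack `r`, executes the
program `c`, and outputs whether stack `o` is nonempty. -/
def mainCode : Option (Option (c.Lbl tm.Λ)) →
    TM2.Stmt (Alph K B A tm) (Option (Option (c.Lbl tm.Λ))) (tm.σ × Option B)
  | none => .pop (.inr (.inr true)) (fun s x => (s.1, x.map emb)) (.branch (fun s => s.2.isSome)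
      (.push (.inl r) (fun s => s.2.getD default) (.goto fun _ => none))
      (.goto fun _ => some (some (c.entry tm.Λ))))
  | some none => .pop (.inl o) (fun s x => (s.1, x)) (.push (.inr (.inr false))
      (fun s => s.2.isSome) (.load (fun s => (s.1, none)) .halt))
  | some (some l) => c.code enc dec (fun l => some (some l)) (some none) l

/-- The machine with the statements `mainCode`. -/
noncomputable def machine [Fintype K] [Fintype B] [Fintype A] : FinTM2 :=
  letI := tm.kFin
  letI := tm.ΛFin
  letI := tm.σFin
  letI : DecidableEq tm.K := tm.kDecidableEq
  letI : Finite (c.Lbl tm.Λ) := finite_lbl _ c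
  letI : Fintype (c.Lbl tm.Λ) := Fintype.ofFinite _
  { K := K ⊕ tm.K ⊕ Bool
    k₀ := .inr (.inr true)
    k₁ := .inr (.inr false)
    Γ := Alph K B A tm
    Λ := Option (Option (c.Lbl tm.Λ))
    main := none
    σ := tm.σ × Option B
    initialState := (tm.initialState, none)
    Γk₀Fin := inferInstanceAs (Fintype A)
    m := mainCode enc dec emb r o c }

theorem reachIn_copy_input (a : List A) : ∀ (R : K → List B) (v : Option B),
    ReachIn (TM2.step (mainCode (tm := tm) enc dec emb r o c)) (a.length + 1)
      ⟨some none, (tm.initialState, v), glue tm R (fun _ => []) a []⟩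
      ⟨some (some (some (c.entry tm.Λ))), (tm.initialState, none),
        glue tm (update R r (a.reverse.map emb ++ R r)) (fun _ => []) [] []⟩ := by
  induction a with
  | nil =>
    intro R v
    refine ReachIn.step ?_
    simp only [mainCode, stepAux_pop_input, TM2.stepAux.eq_5, TM2.stepAux.eq_6]
    simp
  | cons x a ih =>
    intro R v
    have h' := ih (update R r (emb x :: R r)) (some (emb x))
    simp only [update_idem, update_self, List.map_reverse] at h'
    simp only [List.reverse_cons, List.map_append, List.map_reverse, List.append_assoc,
      List.length_cons, List.map_cons, List.map_nil, List.cons_append, List.nil_append]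
    refine ((ReachIn.step ?_).trans h').mono (by omega)
    simp only [mainCode, stepAux_pop_input, stepAux_push_inl, TM2.stepAux.eq_5, TM2.stepAux.eq_6]
    simp

/-- The halting configuration prescribed by `haltList` has the initial internal state and no stack
contents besides the output. Hence the program must end with at most one symbol, on stack `o`, which
the output step pops, and the symbol buffer is reset. The summand 2 pays for noticing the end of the
input and for the output step. -/
theorem reachIn_mainCode {g : List B → List B} {t : List B → ℕ}
    (hg : ∀ l, ∃ out : List (tm.Γ tm.k₁), out.map dec = g l ∧
      Nonempty (TM2OutputsInTime tm (l.map enc) (some out) (t l))) {a : List A} {x : Option B}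
    {n : ℕ} (h : Runs g t c (update (fun _ => []) r (a.reverse.map emb))
      (update (fun _ => []) o x.toList) n) :
    ReachIn (TM2.step (mainCode (tm := tm) enc dec emb r o c)) (a.length + n + 2)
      ⟨some none, (tm.initialState, none), glue tm (fun _ => []) (fun _ => []) a []⟩
      ⟨none, (tm.initialState, none),
        glue tm (fun _ => []) (fun _ => []) [] [x.isSome]⟩ := by
  have h₁ := reachIn_copy_input (tm := tm) enc dec emb r o c a (fun _ => []) none
  rw [List.append_nil] at h₁
  obtain ⟨v, h₂⟩ := reachIn_of_runs (A := A) (M := mainCode enc dec emb r o c) [] [] hg h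
    (ι := fun l => some (some l)) (ret := some none) (fun l => rfl) none
  refine ((h₁.trans h₂).trans (ReachIn.step ?_)).mono (by omega)
  simp only [mainCode, stepAux_pop_inl, stepAux_push_output, TM2.stepAux.eq_4, TM2.stepAux.eq_7]
  cases x <;> simp

/-- A program whose cost is bounded by a polynomial in the length of its input decides a language
in polynomial time. -/
theorem computable_of_runs [Fintype K] [Fintype B] [Fintype A] {g : List B → List B} {t : List B → ℕ}
    (hg : ∀ l, ∃ out : List (tm.Γ tm.k₁), out.map dec = g l ∧
      Nonempty (TM2OutputsInTime tm (l.map enc) (some out) (t l))) (p : Polynomial ℕ)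
    (f : List A → Bool) (b : B)
    (h : ∀ a, Runs g t c (update (fun _ => []) r (a.reverse.map emb))
      (update (fun _ => []) o (if f a then [b] else [])) (p.eval a.length)) :
    Nonempty (TM2ComputableInPolyTime (id : List A → List A) Computability.encodeBool f) := by
  refine ⟨⟨⟨machine enc dec emb r o c, Equiv.refl A, Equiv.refl Bool⟩, p + Polynomial.X + 2,
    fun a => ?_⟩⟩
  have h' := reachIn_mainCode (tm := tm) enc dec emb r o c hg (a := a)
    (x := if f a then some b else none) (n := p.eval a.length)
    (by convert! h a using 2; cases f a <;> rfl)
  refine Classical.choice ?_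
  obtain ⟨m, hm, e⟩ := h'
  refine ⟨⟨⟨m, ?_⟩, hm.trans (by simp; omega)⟩⟩
  have hin : initList (machine enc dec emb r o c) (List.map (Equiv.refl A).invFun (id a)) =
      ⟨some none, (tm.initialState, none), glue tm (fun _ => []) (fun _ => []) a []⟩ := by
    refine congrArg (TM2.Cfg.mk _ _) (funext fun k => ?_)
    rcases k with k | k | _ | _
    · rfl
    · rfl
    · rfl
    · exact List.map_id a
  have hout : haltList (machine enc dec emb r o c)
      (List.map (Equiv.refl Bool).invFun (Computability.encodeBool (f a))) =
      ⟨none, (tm.initialState, none), glue tm (fun _ => []) (fun _ => []) []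
        [(if f a then some b else none).isSome]⟩ := by
    refine congrArg (TM2.Cfg.mk _ _) (funext fun k => ?_)
    rcases k with k | k | _ | _
    · rfl
    · rfl
    · change [f a] = [_]
      cases f a <;> rfl
    · rfl
  rw [Option.map_some, hin, hout]
  exact e

end Main

end Compile

end Cmd

/-! ### The length of the output of a machine -/

namespace Turing.TM2

/-- The number of push instructions of a statement. -/
def Stmt.pushes {K : Type} {Γ : K → Type} {Λ σ : Type} : Stmt Γ Λ σ → ℕ
  | .push _ _ q => q.pushes + 1
  | .peek _ _ q => q.pushes
  | .pop _ _ q => q.pushes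
  | .load _ q => q.pushes
  | .branch _ q r => q.pushes + r.pushes
  | .goto _ => 0
  | .halt => 0

/-- One step executes a whole statement and may push several times; counting the pushes of both
branches is a crude but sufficient bound. -/
theorem length_stepAux_le {K : Type} [DecidableEq K] {Γ : K → Type} {Λ σ : Type} (k : K)
    (q : Stmt Γ Λ σ) : ∀ (v : σ) (S : ∀ k, List (Γ k)),
      ((stepAux q v S).stk k).length ≤ (S k).length + q.pushes := by
  induction q with
  | push k' f q ih =>
    intro v S
    refine (ih _ _).trans ?_
    by_cases h : k = k'
    · subst h
      simp only [Stmt.pushes, update_self, List.length_cons]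
      omega
    · simp only [Stmt.pushes, update_of_ne h]
      omega
  | peek k' f q ih => intro v S; exact ih _ _
  | pop k' f q ih =>
    intro v S
    refine (ih _ _).trans ?_
    by_cases h : k = k'
    · subst h
      simp [Stmt.pushes]
    · simp [Stmt.pushes, h]
  | load f q ih => intro v S; exact ih _ _
  | branch f q r ihq ihr =>
    intro v S
    simp only [stepAux, Stmt.pushes]
    cases f v
    · exact (ihr _ _).trans (by omega)
    · exact (ihq _ _).trans (by omega)
  | goto f => intro v S; simp [stepAux]
  | halt => intro v S; simp [stepAux]

end Turing.TM2

/-- Every step lengthens a stack by at most the largest number of pushes in a statement. Polynomial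
time thus forces polynomially long outputs, which limits how many images the pruning has to tell
apart. -/
theorem Turing.FinTM2.exists_length_output_le (tm : FinTM2) : ∃ C : ℕ,
    ∀ {l : List (tm.Γ tm.k₀)} {out : List (tm.Γ tm.k₁)} {n : ℕ},
      TM2OutputsInTime tm l (some out) n → out.length ≤ l.length + C * n := by
  refine ⟨(@Finset.univ _ tm.ΛFin).sup fun l => (tm.m l).pushes, fun {l out n} h => ?_⟩
  set C := (@Finset.univ _ tm.ΛFin).sup fun l => (tm.m l).pushes
  have key : ∀ (m : ℕ) (c : tm.Cfg), (flip bind tm.step)^[m] (some (initList tm l)) = some c →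
      (c.stk tm.k₁).length ≤ l.length + C * m := by
    intro m
    induction m with
    | zero =>
      intro c hc
      cases hc
      -- The output stack may be the input stack, so it can start with length `l.length`.
      simp only [initList]
      split
      · rename_i h
        have : ∀ (k : tm.K) (h : k = tm.k₀) (e : List (tm.Γ tm.k₀) = List (tm.Γ k)),
            (e.mp l).length = l.length := by rintro k rfl e; rfl
        exact (this _ h _).le
      · simp
    | succ m ih =>
      intro c hc
      rw [iterate_succ_apply'] at hc
      obtain ⟨e, he, hd⟩ := Option.bind_eq_some_iff.1 hc
      have h₁ := ih e he
      rcases e with ⟨_ | l', s, E⟩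
      · cases hd
      · cases hd
        refine (TM2.length_stepAux_le tm.k₁ (tm.m l') s E).trans ?_
        have : (tm.m l').pushes ≤ C :=
          Finset.le_sup (f := fun l => (tm.m l).pushes) (@Finset.mem_univ _ tm.ΛFin l')
        have h₁' : (E tm.k₁).length ≤ l.length + C * m := h₁
        rw [Nat.mul_succ]
        omega
  have := key h.steps _ h.evals_in_steps
  simp only [haltList, ↓reduceDIte] at this
  exact this.trans (Nat.add_le_add_left (Nat.mul_le_mul_left C h.steps_le_m) _)

theorem Polynomial.eval_mono_nat (p : Polynomial ℕ) {m n : ℕ} (h : m ≤ n) :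
    p.eval m ≤ p.eval n := by
  rw [Polynomial.eval_eq_sum, Polynomial.eval_eq_sum]
  exact Finset.sum_le_sum fun i _ => Nat.mul_le_mul_left _ (Nat.pow_le_pow_left h i)

namespace PropSAT

/-! ### Evaluation and substitution on strings -/

/-- Whether a letter is a binary digit. -/
def Letter.isDigit : Letter → Bool
  | .zero => true
  | .one => true
  | _ => false

/-- The constant with the given truth value. -/
def Letter.const (b : Bool) : Letter :=
  if b then .verum else .falsum

/-- The effect of a constant or a connective on a stack of truth values. -/
def Letter.op : Letter → List Bool → Option (List Bool)
  | .verum, l => some (true :: l)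
  | .falsum, l => some (false :: l)
  | .neg, b :: l => some ((!b) :: l)
  | .conj, b :: c :: l => some ((b && c) :: l)
  | .disj, b :: c :: l => some ((b || c) :: l)
  | _, _ => none

/-- The digits at the start of a string. -/
abbrev digits (s : List Letter) : List Letter := s.takeWhile Letter.isDigit

/-- The values of the formulas of which a string is the concatenation, up to digits at the start;
`none` if the string is not of this form. -/
def evalString (v : List Letter → Bool) : List Letter → Option (List Bool)
  | [] => some []
  | a :: s =>
    if a.isDigit then evalString v s
    else if a = .x then (evalString v s).map (v (digits s) :: ·)
    else if digits s = [] then (evalString v s).bind a.op else none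

theorem evalString_dropWhile (v : List Letter → Bool) (s : List Letter) :
    evalString v (s.dropWhile Letter.isDigit) = evalString v s := by
  induction s with
  | nil => rfl
  | cons a s ih =>
    by_cases h : a.isDigit
    · simp [h, ih, evalString]
    · simp [h]

theorem evalString_digits_append (v : List Letter → Bool) (w s : List Letter)
    (hw : ∀ a ∈ w, a.isDigit) : evalString v (w ++ s) = evalString v s := by
  induction w with
  | nil => rfl
  | cons a w ih =>
    simp only [List.mem_cons, forall_eq_or_imp] at hw
    simp [evalString, hw.1, ih hw.2]

theorem Letter.isDigit_ofBit (b : Bool) : (Letter.ofBit b).isDigit := by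
  cases b <;> rfl

theorem digits_encode_append (F : Formula) (s : List Letter) : digits (F.encode ++ s) = [] := by
  cases F <;> simp [Formula.encode, Letter.isDigit, digits]

/-- Without `hs`, digits at the start of `s` would be absorbed into the name of a variable at the
end of `F`. -/
theorem evalString_encode_append (v : List Letter → Bool) (F : Formula) (s : List Letter)
    (hs : digits s = []) : evalString v (F.encode ++ s) =
      (evalString v s).map (F.eval (fun w => v (w.map Letter.ofBit)) :: ·) := by
  induction F generalizing s with
  | verum | falsum =>
    cases h : evalString v s <;>
      simp [Formula.encode, evalString, Letter.isDigit, hs, h, Letter.op, Formula.eval]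
  | var w =>
    have hw : ∀ a ∈ w.map Letter.ofBit, a.isDigit := by
      intro a ha
      obtain ⟨b, _, rfl⟩ := List.mem_map.1 ha
      exact Letter.isDigit_ofBit b
    have hd : digits (w.map Letter.ofBit ++ s) = w.map Letter.ofBit := by
      rw [digits, List.takeWhile_append_of_pos hw, show s.takeWhile _ = [] from hs, List.append_nil]
    simp only [Formula.encode, List.cons_append, evalString, Letter.isDigit, Bool.false_eq_true,
      if_false, if_true, evalString_digits_append v _ s hw, Formula.eval, hd]
  | neg F ih =>
    simp only [Formula.encode, List.cons_append, evalString, Letter.isDigit, Bool.false_eq_true,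
      if_false, reduceCtorEq, digits_encode_append, if_true, ih s hs]
    cases evalString v s <;> simp [Letter.op, Formula.eval]
  | conj F G ihF ihG | disj F G ihF ihG =>
    simp only [Formula.encode, List.cons_append, evalString, Letter.isDigit, Bool.false_eq_true,
      if_false, reduceCtorEq, digits_encode_append, if_true, ihG s hs, List.append_assoc,
      ihF _ (digits_encode_append _ _)]
    cases evalString v s <;> simp [Letter.op, Formula.eval]

theorem exists_map_ofBit {w : List Letter} (hw : ∀ a ∈ w, a.isDigit) :
    ∃ u : List Bool, u.map Letter.ofBit = w := by
  refine ⟨w.map (· = .one), ?_⟩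
  rw [List.map_map]
  refine (List.map_congr_left fun a ha => ?_).trans (List.map_id w)
  have := hw a ha
  cases a <;> simp_all [Letter.isDigit, Letter.ofBit]

/-- A successful evaluation is also a parse: each value on the stack belongs to one complete
formula, and a connective consumes as many formulas as values. -/
theorem exists_formulas_of_evalString (v : List Letter → Bool) {s : List Letter} {l : List Bool}
    (h : evalString v s = some l) : ∃ Fs : List Formula,
      s.dropWhile Letter.isDigit = Fs.flatMap Formula.encode ∧
        l = Fs.map (Formula.eval fun w => v (w.map Letter.ofBit)) := by
  induction s generalizing l with
  | nil => exact ⟨[], by simpa [evalString, eq_comm] using h⟩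
  | cons a s ih =>
    by_cases ha : a.isDigit
    · simp only [evalString, ha, if_true] at h
      simpa [ha] using ih h
    simp only [evalString, ha, if_false, Bool.false_eq_true] at h
    rw [List.dropWhile_cons_of_neg ha]
    by_cases hx : a = .x
    · simp only [hx, if_true, Option.map_eq_some_iff] at h
      obtain ⟨l', h', rfl⟩ := h
      obtain ⟨Fs, hs, rfl⟩ := ih h'
      obtain ⟨u, hu⟩ := exists_map_ofBit (w := digits s) fun a ha =>
        List.mem_takeWhile_imp ha
      refine ⟨.var u :: Fs, ?_, ?_⟩
      · simp only [List.flatMap_cons, Formula.encode, hu, List.cons_append, hx, ← hs,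
          List.takeWhile_append_dropWhile]
      · simp [Formula.eval, hu]
    · simp only [hx, if_false] at h
      split_ifs at h with hd
      rw [Option.bind_eq_some_iff] at h
      obtain ⟨l', h', hl⟩ := h
      obtain ⟨Fs, hs, rfl⟩ := ih h'
      have hs' : s = Fs.flatMap Formula.encode := by
        rw [← hs]
        conv_lhs => rw [← List.takeWhile_append_dropWhile (p := Letter.isDigit) (l := s)]
        rw [show s.takeWhile Letter.isDigit = [] from hd, List.nil_append]
      cases a with
      | zero | one | x => simp [Letter.isDigit] at ha hx
      | verum =>
        simp only [Letter.op, Option.some.injEq] at hl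
        exact ⟨.verum :: Fs, by simp [Formula.encode, ← hs'], by simp [← hl, Formula.eval]⟩
      | falsum =>
        simp only [Letter.op, Option.some.injEq] at hl
        exact ⟨.falsum :: Fs, by simp [Formula.encode, ← hs'], by simp [← hl, Formula.eval]⟩
      | neg =>
        rcases Fs with _ | ⟨F, Fs⟩
        · simp [Letter.op] at hl
        simp only [Letter.op, List.map_cons, Option.some.injEq] at hl
        exact ⟨.neg F :: Fs, by simp [Formula.encode, hs'], by simp [← hl, Formula.eval]⟩
      | conj =>
        rcases Fs with _ | ⟨F, _ | ⟨G, Fs⟩⟩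
        · simp [Letter.op] at hl
        · simp [Letter.op] at hl
        simp only [Letter.op, List.map_cons, Option.some.injEq] at hl
        exact ⟨.conj F G :: Fs, by simp [Formula.encode, hs'], by simp [← hl, Formula.eval]⟩
      | disj =>
        rcases Fs with _ | ⟨F, _ | ⟨G, Fs⟩⟩
        · simp [Letter.op] at hl
        · simp [Letter.op] at hl
        simp only [Letter.op, List.map_cons, Option.some.injEq] at hl
        exact ⟨.disj F G :: Fs, by simp [Formula.encode, hs'], by simp [← hl, Formula.eval]⟩

/-- This replaces formulas by an evaluation of raw strings. The condition on `digits s` excludes the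
stray leading digits that `evalString` tolerates. -/
theorem mem_SAT_iff (s : List Letter) :
    s ∈ SAT ↔ ∃ v, evalString v s = some [true] ∧ digits s = [] := by
  constructor
  · rintro ⟨F, rfl, v, hv⟩
    refine ⟨fun w => v (w.map (· = .one)), ?_, by simpa using digits_encode_append F []⟩
    have h := evalString_encode_append (fun w => v (w.map (· = .one))) F [] rfl
    have hv' : (fun w : List Bool => v ((w.map Letter.ofBit).map (· = .one))) = v := by
      funext w
      rw [List.map_map]
      congr 1
      refine (List.map_congr_left fun b _ => ?_).trans (List.map_id w)
      cases b <;> simp [Letter.ofBit]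
    rw [hv', hv, List.append_nil] at h
    exact h
  · rintro ⟨v, hv, hs⟩
    obtain ⟨Fs, hFs, hl⟩ := exists_formulas_of_evalString v hv
    have hs' := List.takeWhile_append_dropWhile (p := Letter.isDigit) (l := s)
    rw [show s.takeWhile Letter.isDigit = [] from hs, List.nil_append] at hs'
    rcases Fs with _ | ⟨F, _ | ⟨G, Fs⟩⟩
    · simp at hl
    · simp only [List.map_cons, List.map_nil, List.cons.injEq, and_true] at hl
      exact ⟨F, by simpa [hs', eq_comm] using hFs, _, hl.symm⟩
    · simp at hl

/-! ### Self-reducibility by substitution -/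

/-- Replace the variable with name `w` by the letter `c`. -/
def subst (w : List Letter) (c : Letter) : List Letter → List Letter
  | [] => []
  | a :: s =>
    if a = .x ∧ digits s = w then c :: (subst w c s).drop w.length else a :: subst w c s

theorem Letter.isDigit_const (b : Bool) : (Letter.const b).isDigit = false := by
  cases b <;> rfl

/-- Only the non-digit `x` is replaced, and by a non-digit. So the name after an `x` is intact when
the rest has been substituted, and the `drop` in `subst` removes exactly this name. -/
theorem digits_subst (w : List Letter) (b : Bool) (s : List Letter) :
    digits (subst w (.const b) s) = digits s := by
  induction s with
  | nil => rfl
  | cons a s ih =>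
    rw [subst]
    split_ifs with h
    · rw [digits, digits, List.takeWhile_cons_of_neg (by simp [Letter.isDigit_const]),
        List.takeWhile_cons_of_neg (by simp [h.1, Letter.isDigit])]
    · by_cases ha : a.isDigit
      · simpa [digits, ha] using ih
      · simp [digits, ha]

theorem digits_dropWhile (s : List Letter) : digits (s.dropWhile Letter.isDigit) = [] := by
  induction s with
  | nil => rfl
  | cons a s ih =>
    by_cases h : a.isDigit
    · simpa [h] using ih
    · simp [h, digits]

theorem drop_digits (s : List Letter) :
    s.drop (digits s).length = s.dropWhile Letter.isDigit := by
  induction s with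
  | nil => rfl
  | cons a s ih =>
    by_cases h : a.isDigit
    · simpa [h, digits] using ih
    · simp [h, digits]

theorem drop_subst (w : List Letter) (b : Bool) (s : List Letter) :
    (subst w (.const b) s).drop (digits s).length =
      (subst w (.const b) s).dropWhile Letter.isDigit := by
  rw [← drop_digits, digits_subst]

theorem evalString_subst (v : List Letter → Bool) (w : List Letter) (b : Bool) (s : List Letter) :
    evalString v (subst w (.const b) s) = evalString (update v w b) s := by
  induction s with
  | nil => rfl
  | cons a s ih =>
    rw [subst]
    split_ifs with h
    · obtain ⟨rfl, rfl⟩ := h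
      rw [drop_subst]
      have hb : Letter.const b ≠ .x := by cases b <;> simp [Letter.const]
      have hop : (Letter.const b).op = fun l => some (b :: l) := by
        funext l; cases b <;> rfl
      simp only [evalString, Letter.isDigit_const, digits_dropWhile, evalString_dropWhile, ih, hb,
        hop, Bool.false_eq_true, if_false, if_true, show Letter.x.isDigit = false from rfl, update_self,
        Option.map_eq_bind, Function.comp_def]
    · by_cases hx : a = .x
      · subst hx
        have hw : digits s ≠ w := fun h' => h ⟨rfl, h'⟩
        simp [evalString, digits_subst, ih, Letter.isDigit, hw]
      · simp only [evalString, digits_subst, ih, hx, if_false]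

theorem subst_of_notMem (w : List Letter) (c : Letter) {s : List Letter} (h : .x ∉ s) :
    subst w c s = s := by
  induction s with
  | nil => rfl
  | cons a s ih =>
    simp only [List.mem_cons, not_or] at h
    rw [subst, if_neg (fun h' => h.1 h'.1.symm), ih h.2]

theorem length_subst_le (w : List Letter) (c : Letter) (s : List Letter) :
    (subst w c s).length ≤ s.length := by
  induction s with
  | nil => exact le_rfl
  | cons a s ih =>
    rw [subst]
    split_ifs
    · simp only [List.length_cons, List.length_drop]; omega
    · simpa using ih

theorem count_subst_le (w : List Letter) (b : Bool) (s : List Letter) :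
    (subst w (.const b) s).count .x ≤ s.count .x := by
  induction s with
  | nil => exact le_rfl
  | cons a s ih =>
    rw [subst]
    split_ifs
    · rw [List.count_cons_of_ne (by cases b <;> simp [Letter.const])]
      exact ((List.drop_sublist ..).count_le _).trans (ih.trans List.count_le_count_cons)
    · rw [List.count_cons, List.count_cons]
      omega

/-- The name of the last variable of a string. -/
def lastVar : List Letter → Option (List Letter)
  | [] => none
  | a :: s => if a = .x then some ((lastVar s).getD (digits s)) else lastVar s

theorem lastVar_eq_none {s : List Letter} : lastVar s = none ↔ .x ∉ s := by
  induction s with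
  | nil => simp [lastVar]
  | cons a s ih =>
    rw [lastVar]
    split_ifs with h
    · simp [h]
    · simp [ih, Ne.symm h]

/-- Replace the last variable of a string by the constant with the given truth value. -/
def substLast (b : Bool) (s : List Letter) : List Letter :=
  subst ((lastVar s).getD []) (.const b) s

theorem substLast_of_none (b : Bool) {s : List Letter} (h : lastVar s = none) :
    substLast b s = s :=
  subst_of_notMem _ _ (lastVar_eq_none.1 h)

theorem length_substLast_le (b : Bool) (s : List Letter) :
    (substLast b s).length ≤ s.length :=
  length_subst_le _ _ _

/-- This and the next two lemmas describe `substLast` by recursion from the right. The last variable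
is the first one met in that direction, so its name is fixed from then on and a single pass
suffices. -/
theorem substLast_cons_of_ne (b : Bool) {a : Letter} (ha : a ≠ .x) (s : List Letter) :
    substLast b (a :: s) = a :: substLast b s := by
  simp [substLast, subst, lastVar, ha]

theorem substLast_cons_of_eq (b : Bool) {s : List Letter}
    (h : (lastVar s).getD (digits s) = digits s) :
    substLast b (.x :: s) = .const b :: (substLast b s).drop (digits s).length := by
  simp only [substLast, subst, lastVar, if_true, Option.getD_some, h, true_and]
  -- If `s` has no variable, the default name `[]` need not be `digits s`, but substitution leaves
  -- `s` alone under either name.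
  rcases h' : lastVar s with _ | w
  · rw [subst_of_notMem _ _ (lastVar_eq_none.1 h'), subst_of_notMem _ _ (lastVar_eq_none.1 h')]
  · rw [h', Option.getD_some] at h
    rw [Option.getD_some, h]

theorem substLast_cons_of_getD_ne (b : Bool) {s : List Letter}
    (h : (lastVar s).getD (digits s) ≠ digits s) :
    substLast b (.x :: s) = .x :: substLast b s := by
  rcases h' : lastVar s with _ | w
  · simp [h'] at h
  · simp only [h', Option.getD_some] at h
    simp [substLast, subst, lastVar, h', Ne.symm h]

/-- The decrease is strict because the rightmost occurrence of `x` is always replaced; further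
replacements can only lower the count more. -/
theorem count_substLast_lt (b : Bool) {s : List Letter} (h : .x ∈ s) :
    (substLast b s).count .x < s.count .x := by
  induction s with
  | nil => simp at h
  | cons a s ih =>
    by_cases ha : a = .x
    · subst ha
      rw [List.count_cons_self]
      by_cases hd : (lastVar s).getD (digits s) = digits s
      · rw [substLast_cons_of_eq b hd,
          List.count_cons_of_ne (by cases b <;> simp [Letter.const])]
        exact Nat.lt_succ_of_le (((List.drop_sublist ..).count_le _).trans (count_subst_le ..))
      -- With no variable to its right, the current `x` would itself start the last variable,
      -- contrary to `hd`.
      · have hx : .x ∈ s := by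
          by_contra hx
          rw [lastVar_eq_none.2 hx] at hd
          exact hd rfl
        rw [substLast_cons_of_getD_ne b hd, List.count_cons_self]
        exact Nat.succ_lt_succ (ih hx)
    · rw [substLast_cons_of_ne b ha, List.count_cons_of_ne ha, List.count_cons_of_ne ha]
      exact ih (by simpa [Ne.symm ha] using h)

theorem count_substLast_le (b : Bool) (s : List Letter) :
    (substLast b s).count .x ≤ s.count .x - 1 := by
  by_cases h : .x ∈ s
  · exact Nat.le_pred_of_lt (count_substLast_lt b h)
  · rw [substLast_of_none b (lastVar_eq_none.2 h), List.count_eq_zero_of_not_mem h]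

/-- Self-reducibility of SAT. -/
theorem mem_SAT_iff_substLast (s : List Letter) :
    s ∈ SAT ↔ substLast true s ∈ SAT ∨ substLast false s ∈ SAT := by
  simp only [mem_SAT_iff, substLast, evalString_subst, digits_subst]
  constructor
  · rintro ⟨v, hv, hs⟩
    set w := (lastVar s).getD []
    cases h : v w
    · exact .inr ⟨v, by rw [update_eq_self_iff.2 h.symm, hv], hs⟩
    · exact .inl ⟨v, by rw [update_eq_self_iff.2 h.symm, hv], hs⟩
  · rintro (⟨v, hv, hs⟩ | ⟨v, hv, hs⟩)
    · exact ⟨_, hv, hs⟩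
    · exact ⟨_, hv, hs⟩

/-! ### Strings without variables -/

/-- The values of the variable-free formulas of which a string is the concatenation. -/
def evalClosed : List Letter → Option (List Bool)
  | [] => some []
  | a :: s => (evalClosed s).bind a.op

/-- Without `x` every digit is misplaced. `evalClosed` fails at once since `Letter.op` is undefined
on digits, whereas `evalString` fails only at the next letter; the test on `digits s` makes up for
the difference. -/
theorem evalString_of_notMem (v : List Letter → Bool) {s : List Letter} (h : .x ∉ s) :
    (if digits s = [] then evalString v s else none) = evalClosed s := by
  induction s with
  | nil => rfl
  | cons a s ih =>
    simp only [List.mem_cons, not_or] at h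
    rw [evalClosed, ← ih h.2]
    by_cases ha : a.isDigit
    · have : a.op = fun _ => none := by
        funext l; cases a <;> simp_all [Letter.isDigit, Letter.op]
      simp [digits, ha, this]
    · have hd : digits (a :: s) = [] := by simp [digits, ha]
      rw [if_pos hd, evalString, if_neg ha, if_neg (Ne.symm h.1)]
      split_ifs <;> simp

theorem mem_SAT_iff_evalClosed {s : List Letter} (h : .x ∉ s) :
    s ∈ SAT ↔ evalClosed s = some [true] := by
  rw [mem_SAT_iff]
  constructor
  · rintro ⟨v, hv, hs⟩
    rw [← evalString_of_notMem v h, if_pos hs, hv]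
  · intro h'
    rw [← evalString_of_notMem (fun _ => true) h] at h'
    split_ifs at h' with hs
    exact ⟨_, h', hs⟩

/-! ### The stacks of the decision procedure -/

/-- The stack symbols: letters and a separator. -/
abbrev Sym : Type := Option Letter

/-- The stacks of the decision procedure: the current list of formulas and the next one, a counter,
the formula that is being read and its two instances, the table of values of the reduction, and
auxiliary stacks. -/
inductive Reg where
  | cur | nxt | cnt | pend | name | named | copy | aux | bad | inst₁ | inst₀ | arg | val | hold
  | tab | args | res
  deriving DecidableEq

instance : Fintype Reg where
  elems := {.cur, .nxt, .cnt, .pend, .name, .named, .copy, .aux, .bad, .inst₁, .inst₀, .arg, .val,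
    .hold, .tab, .args, .res}
  complete k := by cases k <;> simp

/-- The contents of the stacks. -/
structure St where
  cur : List Sym
  nxt : List Sym
  cnt : List Sym
  pend : List Sym
  name : List Sym
  named : List Sym
  copy : List Sym
  aux : List Sym
  bad : List Sym
  inst₁ : List Sym
  inst₀ : List Sym
  arg : List Sym
  val : List Sym
  hold : List Sym
  tab : List Sym
  args : List Sym
  res : List Sym

namespace St

/-- The content of one stack. -/
def get (S : St) : Reg → List Sym
  | .cur => S.cur
  | .nxt => S.nxt
  | .cnt => S.cnt
  | .pend => S.pend
  | .name => S.name
  | .named => S.named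
  | .copy => S.copy
  | .aux => S.aux
  | .bad => S.bad
  | .inst₁ => S.inst₁
  | .inst₀ => S.inst₀
  | .arg => S.arg
  | .val => S.val
  | .hold => S.hold
  | .tab => S.tab
  | .args => S.args
  | .res => S.res

/-- Change the content of one stack. -/
def set (S : St) (k : Reg) (l : List Sym) : St :=
  match k with
  | .cur => { S with cur := l }
  | .nxt => { S with nxt := l }
  | .cnt => { S with cnt := l }
  | .pend => { S with pend := l }
  | .name => { S with name := l }
  | .named => { S with named := l }
  | .copy => { S with copy := l }
  | .aux => { S with aux := l }
  | .bad => { S with bad := l }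
  | .inst₁ => { S with inst₁ := l }
  | .inst₀ => { S with inst₀ := l }
  | .arg => { S with arg := l }
  | .val => { S with val := l }
  | .hold => { S with hold := l }
  | .tab => { S with tab := l }
  | .args => { S with args := l }
  | .res => { S with res := l }

theorem get_set (S : St) (k : Reg) (l : List Sym) : (S.set k l).get = update S.get k l := by
  funext j
  cases k <;> cases j <;> rfl

/-- Through this, identities between records of stacks follow from those of `update`; records let
concrete states be compared by `rfl` or `simp`. -/
theorem get_injective : Injective get := by
  intro S S' h
  have h' := congrFun h
  cases S
  cases S'
  simp only [St.mk.injEq]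
  exact ⟨h' .cur, h' .nxt, h' .cnt, h' .pend, h' .name, h' .named, h' .copy, h' .aux, h' .bad,
    h' .inst₁, h' .inst₀, h' .arg, h' .val, h' .hold, h' .tab, h' .args, h' .res⟩

theorem get_set_self (S : St) (k : Reg) (l : List Sym) : (S.set k l).get k = l := by
  rw [get_set, update_self]

theorem get_set_of_ne (S : St) {j k : Reg} (h : j ≠ k) (l : List Sym) :
    (S.set k l).get j = S.get j := by
  rw [get_set, update_of_ne h]

theorem set_get (S : St) (k : Reg) : S.set k (S.get k) = S :=
  get_injective (by rw [get_set, update_eq_self])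

theorem set_set (S : St) (k : Reg) (l l' : List Sym) : (S.set k l).set k l' = S.set k l' :=
  get_injective (by simp only [get_set, update_idem])

theorem set_comm (S : St) {j k : Reg} (h : j ≠ k) (l l' : List Sym) :
    (S.set j l).set k l' = (S.set k l').set j l :=
  get_injective (by simp only [get_set, update_comm h])

/-- All stacks are empty. -/
def empty : St := ⟨[], [], [], [], [], [], [], [], [], [], [], [], [], [], [], [], []⟩

theorem get_empty : empty.get = fun _ => [] := by
  funext j
  cases j <;> rfl

end St

/-! ### Cost semantics on records of stacks -/

/-- The reduction as a function on strings of stack symbols. -/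
def symFun (g : List Letter → List Letter) (l : List Sym) : List Sym :=
  (g (l.map (·.getD .zero))).map some

/-- `Exec g t c S S' n`: the program `c` transforms `S` into `S'` at a cost of at most `n`, where
the reduction `g` costs `t`. -/
def Exec (g : List Letter → List Letter) (t : ℕ → ℕ) (c : Cmd Reg Sym) (S S' : St) (n : ℕ) : Prop :=
  Cmd.Runs (symFun g) (fun l => t l.length) c S.get S'.get n

namespace Exec

variable {g : List Letter → List Letter} {t : ℕ → ℕ} {S S' S₁ S₂ S₃ : St} {c d : Cmd Reg Sym}
  {k i j : Reg} {b : Sym} {l : List Sym} {m n : ℕ}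

theorem mono (h : Exec g t c S S' m) (hmn : m ≤ n) : Exec g t c S S' n := Cmd.Runs.weaken h hmn

theorem skip : Exec g t .skip S S 1 := Cmd.Runs.skip _

theorem push (h : S' = S.set k (b :: S.get k)) : Exec g t (.push k b) S S' 1 := by
  rw [Exec, h, St.get_set]
  exact Cmd.Runs.push _ _ _

theorem seq (h₁ : Exec g t c S₁ S₂ m) (h₂ : Exec g t d S₂ S₃ n) :
    Exec g t (.seq c d) S₁ S₃ (m + n) := Cmd.Runs.seq h₁ h₂

theorem pop {f : Option Sym → Cmd Reg Sym}
    (h : Exec g t (f (S.get k).head?) (S.set k (S.get k).tail) S' n) :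
    Exec g t (.pop k f) S S' (1 + n) := by
  rw [Exec, St.get_set] at h
  exact Cmd.Runs.pop h

theorem pop_nil {f : Option Sym → Cmd Reg Sym} (h : S.get k = []) (h' : Exec g t (f none) S S' n) :
    Exec g t (.pop k f) S S' (1 + n) := by
  refine pop ?_
  rw [h, List.tail_nil, ← h, St.set_get, h]
  exact h'

theorem pop_cons {f : Option Sym → Cmd Reg Sym} (h : S.get k = b :: l)
    (h' : Exec g t (f (some b)) (S.set k l) S' n) : Exec g t (.pop k f) S S' (1 + n) := by
  refine pop ?_
  rw [h]
  exact h'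

theorem pop_skip : Exec g t (.pop k fun _ => .skip) S (S.set k (S.get k).tail) 2 :=
  pop (n := 1) skip

theorem loop_nil {f : Sym → Cmd Reg Sym} (h : S.get k = []) : Exec g t (.loop k f) S S 1 :=
  Cmd.Runs.loop_nil h

theorem loop_cons {f : Sym → Cmd Reg Sym} (h : S.get k = b :: l)
    (h₁ : Exec g t (f b) (S.set k l) S₁ m) (h₂ : Exec g t (.loop k f) S₁ S₂ n) :
    Exec g t (.loop k f) S S₂ (1 + m + n) :=
  Cmd.Runs.loop_cons h (by rw [← St.get_set]; exact h₁) h₂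

/-- The argument consists of letters only, so the value that `symFun` assigns to separators plays no
role. -/
theorem call {s : List Letter} (hs : S.get i = (s.map some).reverse)
    (h : S' = (S.set i []).set j (((g s).map some).reverse ++ (S.set i []).get j)) :
    Exec g t (.call i j) S S' (t s.length + s.length + (g s).length + 2) := by
  have h' := Cmd.Runs.call (g := symFun g) (t := fun l => t l.length) i j S.get
  have e : symFun g (S.get i).reverse = (g s).map some := by
    rw [hs, List.reverse_reverse, symFun, List.map_map]
    congr 2
    exact List.map_id s
  rw [e, hs, ← St.get_set, ← St.get_set, ← h] at h'
  simpa [Exec] using h'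

/-- Move a stack onto another one. -/
theorem move (hij : i ≠ j) (hl : S.get i = l)
    (h : S' = (S.set i []).set j (l.reverse ++ S.get j)) :
    Exec g t (.loop i fun a => .push j a) S S' (2 * l.length + 1) := by
  induction l generalizing S with
  | nil =>
    have : S' = S := by
      rw [h, List.reverse_nil, List.nil_append, ← hl, St.set_get, St.set_get]
    rw [this]
    exact (loop_nil hl).mono (by simp)
  | cons a l ih =>
    refine (loop_cons hl (push rfl) (ih ?_ ?_)).mono (by simp; omega)
    · rw [St.get_set_of_ne _ hij, St.get_set_self]
    · rw [h, St.get_set_self, St.get_set_of_ne _ hij.symm, St.set_comm _ hij.symm, St.set_set,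
        St.set_set, List.reverse_cons, List.append_assoc]
      rfl

/-- Empty a stack. -/
theorem clear (hl : S.get k = l) (h : S' = S.set k []) :
    Exec g t (.loop k fun _ => .skip) S S' (2 * l.length + 1) := by
  induction l generalizing S with
  | nil =>
    have : S' = S := by rw [h, ← hl, St.set_get]
    rw [this]
    exact (loop_nil hl).mono (by simp)
  | cons a l ih =>
    refine (loop_cons hl skip (ih (St.get_set_self ..) ?_)).mono (by simp; omega)
    rw [h, St.set_set]

end Exec

/-! ### Substitution -/

section Subst

variable {g : List Letter → List Letter} {t : ℕ → ℕ}

open Cmd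

/-- Compare the stacks `pend` and `name`: `pend` is moved to `copy`, and `bad` becomes nonempty if
they differ. -/
def compareCmd : Cmd Reg Sym :=
  (loop .pend fun a => push .copy a ;;
    pop .name fun
      | none => push .bad none
      | some b => push .aux b ;; if a = b then skip else push .bad none) ;;
  (loop .name fun b => push .bad none ;; push .aux b) ;;
  loop .aux fun b => push .name b

/-- The first loop can only detect whether `pend` is a prefix of `name`. The exact number of symbols
on `bad` is irrelevant; emptiness and a bound for the cost of clearing it are enough. -/
theorem exec_compareCmd_prefix (p : List Sym) : ∀ S : St, S.pend = p →
    ∃ l : List Sym, (l = [] ↔ S.bad = [] ∧ p <+: S.name) ∧ l.length ≤ S.bad.length + p.length ∧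
      Exec g t (loop .pend fun a => push .copy a ;;
        pop .name fun
          | none => push .bad none
          | some b => push .aux b ;; if a = b then skip else push .bad none) S
        { S with
          pend := []
          name := S.name.drop p.length
          aux := (S.name.take p.length).reverse ++ S.aux
          copy := p.reverse ++ S.copy
          bad := l } (6 * p.length + 1) := by
  induction p with
  | nil =>
    rintro ⟨⟩ rfl
    exact ⟨_, by simp, by simp, Exec.loop_nil rfl⟩
  | cons a p ih =>
    rintro ⟨cur, nxt, cnt, _, name, named, copy, aux, bad, inst₁, inst₀, arg, val, hold, tab, args,
      res⟩ rfl
    rcases name with _ | ⟨b, w⟩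
    · obtain ⟨l, hl, hlen, h⟩ := ih ⟨cur, nxt, cnt, p, [], named, a :: copy, aux, none :: bad,
        inst₁, inst₀, arg, val, hold, tab, args, res⟩ rfl
      refine ⟨l, by simpa using hl, by simp at hlen ⊢; omega, ?_⟩
      simp only [List.drop_nil, List.take_nil, List.reverse_nil, List.nil_append,
        List.reverse_cons, List.append_assoc] at h ⊢
      refine (Exec.loop_cons rfl (Exec.seq (Exec.push rfl) (Exec.pop_nil rfl (Exec.push rfl)))
        h).mono ?_
      simp only [List.length_cons]
      omega
    · obtain ⟨l, hl, hlen, h⟩ := ih ⟨cur, nxt, cnt, p, w, named, a :: copy, b :: aux,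
        if a = b then bad else none :: bad, inst₁, inst₀, arg, val, hold, tab, args, res⟩ rfl
      refine ⟨l, ?_, ?_, ?_⟩
      · rw [hl, List.cons_prefix_cons]
        split_ifs with h' <;> simp [h']
      · split_ifs at hlen <;> simp at hlen ⊢ <;> omega
      simp only [List.drop_succ_cons, List.take_succ_cons, List.reverse_cons, List.append_assoc,
        List.length_cons] at h ⊢
      refine (Exec.loop_cons rfl (Exec.seq (Exec.push rfl) (Exec.pop_cons rfl
        (Exec.seq (Exec.push rfl) (m := 1) (n := 1) ?_))) h).mono (by omega)
      split_ifs
      · exact Exec.skip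
      · exact Exec.push rfl

theorem exec_compareCmd_rest (w : List Sym) : ∀ S : St, S.name = w →
    ∃ l : List Sym, (l = [] ↔ S.bad = [] ∧ w = []) ∧ l.length ≤ S.bad.length + w.length ∧
      Exec g t (loop .name fun b => push .bad none ;; push .aux b) S
        { S with name := [], aux := w.reverse ++ S.aux, bad := l } (3 * w.length + 1) := by
  induction w with
  | nil =>
    rintro ⟨⟩ rfl
    exact ⟨_, by simp, by simp, Exec.loop_nil rfl⟩
  | cons b w ih =>
    rintro ⟨cur, nxt, cnt, pend, _, named, copy, aux, bad, inst₁, inst₀, arg, val, hold, tab, args,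
      res⟩ rfl
    obtain ⟨l, hl, hlen, h⟩ := ih ⟨cur, nxt, cnt, pend, w, named, copy, b :: aux, none :: bad,
      inst₁, inst₀, arg, val, hold, tab, args, res⟩ rfl
    refine ⟨l, by simpa using hl, by simp at hlen ⊢; omega, ?_⟩
    simp only [List.reverse_cons, List.append_assoc] at h ⊢
    refine (Exec.loop_cons rfl (Exec.seq (Exec.push rfl) (Exec.push rfl)) h).mono ?_
    simp only [List.length_cons]
    omega

theorem exec_compareCmd (S : St) (hb : S.bad = []) (ha : S.aux = []) :
    ∃ l : List Sym, (l = [] ↔ S.pend = S.name) ∧ l.length ≤ S.pend.length + S.name.length ∧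
      Exec g t compareCmd S { S with pend := [], copy := S.pend.reverse ++ S.copy, bad := l }
        (10 * (S.pend.length + S.name.length) + 10) := by
  obtain ⟨l₁, hl₁, hlen₁, h₁⟩ := exec_compareCmd_prefix (g := g) (t := t) S.pend S rfl
  obtain ⟨l₂, hl₂, hlen₂, h₂⟩ := exec_compareCmd_rest (g := g) (t := t)
    (S.name.drop S.pend.length) { S with
          pend := []
          name := S.name.drop S.pend.length
          aux := (S.name.take S.pend.length).reverse ++ S.aux
          copy := S.pend.reverse ++ S.copy
          bad := l₁ } rfl
  refine ⟨l₂, ?_, ?_, (Exec.seq h₁ (Exec.seq h₂ (Exec.move (by decide) rfl ?_))).mono ?_⟩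
  · rw [hl₂]
    simp only [hl₁, hb, true_and, List.drop_eq_nil_iff]
    constructor
    -- A prefix that leaves nothing of the word over is the whole word.
    · rintro ⟨h, h'⟩
      exact h.eq_of_length_le h'
    · intro h
      rw [h]
      exact ⟨List.prefix_rfl, le_rfl⟩
  · simp only [hb, List.length_nil, List.length_drop] at hlen₁ hlen₂
    omega
  · simp [St.set, St.get, ha]
  · simp only [St.get, List.length_append, List.length_reverse, List.length_drop,
      List.length_take, ha, List.length_nil]
    omega

/-- Store the name of the variable that has been read if no name has been stored. -/
def nameCmd : Cmd Reg Sym :=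
  pop .named fun
    | some _ => push .named none
    | none =>
      (loop .pend fun a => push .copy a) ;;
      (loop .copy fun a => push .pend a ;; push .name a) ;;
      push .named none

theorem exec_nameCmd_copy (p : List Sym) : ∀ S : St, S.copy = p →
    Exec g t (loop .copy fun a => push .pend a ;; push .name a) S
      { S with copy := [], pend := p.reverse ++ S.pend, name := p.reverse ++ S.name }
      (3 * p.length + 1) := by
  induction p with
  | nil =>
    rintro ⟨⟩ rfl
    exact Exec.loop_nil rfl
  | cons a p ih =>
    rintro S hS
    have h := ih { S with copy := p, pend := a :: S.pend, name := a :: S.name } rfl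
    simp only [List.reverse_cons, List.append_assoc] at h ⊢
    refine (Exec.loop_cons (S := S) (k := .copy) hS (Exec.seq (Exec.push rfl) (Exec.push rfl)) h).mono ?_
    simp only [List.length_cons]
    omega

/-- The flag `named` is needed besides `name` because the empty word is a legitimate variable name.
-/
theorem exec_nameCmd (S : St) (w : Option (List Sym)) (hn : S.name = w.getD [])
    (hd : S.named = if w.isSome then [none] else []) (hc : S.copy = []) :
    Exec g t nameCmd S { S with name := w.getD S.pend, named := [none] }
      (10 * S.pend.length + 10) := by
  rcases w with _ | w
  · refine (Exec.pop_nil (S := S) (k := .named) hd (Exec.seq (Exec.move (by decide) rfl rfl)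
      (Exec.seq (exec_nameCmd_copy _ _ rfl) (Exec.push ?_)))).mono ?_
    · simp at hn hd
      simp [St.set, St.get, hc, hn, hd]
    · simp only [St.get, St.set, hc, List.append_nil, List.length_reverse]
      omega
  · refine (Exec.pop_cons (S := S) (k := .named) (b := none) (l := []) hd (Exec.push ?_)).mono (by omega)
    simp at hn
    simp [St.set, St.get, hn]

/-- Process the start of a variable that has been read. -/
def varCmd : Cmd Reg Sym :=
  nameCmd ;; compareCmd ;;
  pop .bad fun
    | none =>
      (loop .copy fun _ => (pop .inst₁ fun _ => skip) ;; pop .inst₀ fun _ => skip) ;;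
      push .inst₁ (some (.const true)) ;; push .inst₀ (some (.const false))
    | some _ =>
      (loop .bad fun _ => skip) ;; (loop .copy fun _ => skip) ;;
      push .inst₁ (some .x) ;; push .inst₀ (some .x)

/-- Process a letter; a formula is read from right to left. -/
def letterCmd (a : Letter) : Cmd Reg Sym :=
  if a.isDigit then push .pend (some a) ;; push .inst₁ (some a) ;; push .inst₀ (some a)
  else if a = .x then varCmd
  else (loop .pend fun _ => skip) ;; push .inst₁ (some a) ;; push .inst₀ (some a)

/-- The stacks after the string `s` has been read. -/
def scanned (S : St) (s : List Letter) : St :=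
  { S with
    pend := (digits s).map some
    name := ((lastVar s).getD []).map some
    named := if (lastVar s).isSome then [none] else []
    inst₁ := (substLast true s).map some
    inst₀ := (substLast false s).map some }

theorem exec_varCmd_drop (p : List Sym) : ∀ S : St, S.copy = p →
    Exec g t (loop .copy fun _ => (pop .inst₁ fun _ => skip) ;; pop .inst₀ fun _ => skip) S
      { S with copy := [], inst₁ := S.inst₁.drop p.length, inst₀ := S.inst₀.drop p.length }
      (5 * p.length + 1) := by
  induction p with
  | nil =>
    rintro ⟨⟩ rfl
    exact Exec.loop_nil rfl
  | cons a p ih =>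
    rintro S hS
    have h := ih { S with copy := p, inst₁ := S.inst₁.tail, inst₀ := S.inst₀.tail } rfl
    simp only [List.drop_tail] at h
    have hpop₁ : Exec g t (pop .inst₁ fun _ => skip) { S with copy := p }
        { S with copy := p, inst₁ := S.inst₁.tail } 2 := Exec.pop_skip
    have hpop₀ : Exec g t (pop .inst₀ fun _ => skip) { S with copy := p, inst₁ := S.inst₁.tail }
        { S with copy := p, inst₁ := S.inst₁.tail, inst₀ := S.inst₀.tail } 2 := Exec.pop_skip
    refine (Exec.loop_cons (S := S) (k := .copy) hS (Exec.seq hpop₁ hpop₀) h).mono ?_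
    simp only [List.length_cons]
    omega

theorem length_digits_le (s : List Letter) : (digits s).length ≤ s.length :=
  (List.takeWhile_sublist _).length_le

theorem length_lastVar_le (s : List Letter) : ((lastVar s).getD []).length ≤ s.length := by
  induction s with
  | nil => simp [lastVar]
  | cons a s ih =>
    rw [lastVar]
    split_ifs
    · cases h : lastVar s
      · simpa using (length_digits_le s).trans (Nat.le_succ _)
      · simp only [h, Option.getD_some] at ih
        simpa using ih.trans (Nat.le_succ _)
    · exact ih.trans (by simp)

/-- The two outcomes of the comparison are the cases of `substLast_cons_of_eq` and
`substLast_cons_of_getD_ne`. In the first, `copy` holds the digits just read and its length tells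
how much to drop from both instances. -/
theorem exec_varCmd (S : St) (s : List Letter) (hc : S.copy = []) (ha : S.aux = [])
    (hb : S.bad = []) :
    Exec g t varCmd (scanned S s) (scanned S (.x :: s)) (50 * s.length + 50) := by
  have hp := length_digits_le s
  have hw := length_lastVar_le s
  set w := (lastVar s).getD (digits s) with hw'
  have hwl : w.length ≤ s.length := by
    cases h : lastVar s <;> simp_all
  have hname : ((lastVar s).map (List.map some)).getD ((digits s).map some) = w.map some := by
    cases h : lastVar s <;> simp_all
  have h₁ := exec_nameCmd (g := g) (t := t) (scanned S s) ((lastVar s).map (List.map some))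
    (by cases h : lastVar s <;> simp [scanned, h]) (by simp [scanned]) hc
  obtain ⟨l, hl, hlen, h₂⟩ := exec_compareCmd (g := g) (t := t)
    { scanned S s with
      name := ((lastVar s).map (List.map some)).getD (scanned S s).pend, named := [none] } hb ha
  have hd : digits (.x :: s) = [] := by simp [digits, Letter.isDigit]
  have hv : lastVar (.x :: s) = some w := by simp [lastVar, hw']
  simp only [scanned, hname, List.length_map] at h₁ h₂ hl hlen
  have hinj : Injective (List.map (some : Letter → Sym)) :=
    List.map_injective_iff.2 (Option.some_injective _)
  rw [hinj.eq_iff] at hl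
  refine (Exec.seq h₁ (Exec.seq h₂ (n := 15 * s.length + 20) ?_)).mono ?_
  · by_cases h : w = digits s
    · obtain rfl := hl.2 h.symm
      refine (Exec.pop_nil rfl (Exec.seq (exec_varCmd_drop _ _ rfl)
        (Exec.seq (Exec.push rfl) (Exec.push ?_)))).mono ?_
      · simp [scanned, St.set, St.get, hd, hv, substLast_cons_of_eq _ h, hc, hb, List.map_drop]
      · simp only [hc, List.append_nil, List.length_reverse, List.length_map]
        omega
    · rcases l with _ | ⟨b, l⟩
      · exact absurd (hl.1 rfl).symm h
      refine (Exec.pop_cons rfl (Exec.seq (Exec.clear rfl rfl) (Exec.seq (Exec.clear rfl rfl)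
        (Exec.seq (Exec.push rfl) (Exec.push ?_))))).mono ?_
      · simp [scanned, St.set, St.get, hd, hv, substLast_cons_of_getD_ne _ h, hc, hb]
      · simp only [List.length_cons] at hlen
        simp only [St.get, St.set, hc, List.append_nil, List.length_reverse, List.length_map]
        omega
  · omega

theorem exec_letterCmd (S : St) (s : List Letter) (hc : S.copy = []) (ha : S.aux = [])
    (hb : S.bad = []) (a : Letter) :
    Exec g t (letterCmd a) (scanned S s) (scanned S (a :: s)) (50 * s.length + 50) := by
  have hdl := length_digits_le s
  rw [letterCmd]
  split_ifs with h₁ h₂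
  · have hx : a ≠ .x := by rintro rfl; simp [Letter.isDigit] at h₁
    refine (Exec.seq (Exec.push rfl) (Exec.seq (Exec.push rfl) (Exec.push ?_))).mono (by omega)
    simp only [scanned, substLast_cons_of_ne _ hx, lastVar, hx, if_false, digits, h₁,
      List.takeWhile_cons_of_pos]
    rfl
  · subst h₂
    exact exec_varCmd S s hc ha hb
  · refine (Exec.seq (Exec.clear rfl rfl) (Exec.seq (Exec.push rfl) (Exec.push ?_))).mono ?_
    · simp only [scanned, substLast_cons_of_ne _ h₂, lastVar, h₂, if_false, digits,
        List.takeWhile_cons_of_neg h₁]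
      rfl
    · simp only [St.get, scanned, List.length_map]
      omega

end Subst

/-! ### Pruning with the reduction -/

/-- Mark position `n` of a table. -/
def mark (n : ℕ) (l : List Sym) : List Sym :=
  l.takeD n none ++ some .one :: (l.drop n).tail

/-- Add a formula to a list, provided that the reduction maps it to a string of zeros whose length
is not marked in the table, and mark this length. -/
def consider (g : List Letter → List Letter) (s : List Letter)
    (p : List Sym × List (List Letter)) : List Sym × List (List Letter) :=
  if ∀ a ∈ g s, a = .zero then
    (mark (g s).length p.1, if p.1[(g s).length]? = some (some .one) then p.2 else s :: p.2)
  else p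

/-- A list of formulas as the content of a stack. -/
def stackOf (ts : List (List Letter)) : List Sym :=
  ts.flatMap fun s => s.reverse.map some ++ [none]

section Prune

variable {g : List Letter → List Letter} {t : ℕ → ℕ}

open Cmd

/-- Remove the last formula from `nxt`; `hold` has the length of the formula. -/
def discardCmd : Cmd Reg Sym :=
  (loop .hold fun _ => pop .nxt fun _ => skip) ;; pop .nxt fun _ => skip

/-- Look up and mark the length of `copy` in the table, and remove the last formula from `nxt` if it
was marked. -/
def lookupCmd : Cmd Reg Sym :=
  (loop .copy fun _ => pop .tab fun o => push .aux (o.getD none)) ;;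
  pop .tab fun o =>
    push .tab (some .one) ;; (loop .aux fun a => push .tab a) ;;
    if o = some (some .one) then discardCmd else loop .hold fun _ => skip

/-- The program for `consider`, with the formula on stack `inst₁`. -/
def considerCmd : Cmd Reg Sym :=
  push .nxt none ;;
  (loop .inst₁ fun a => push .arg a ;; push .nxt a ;; push .hold a) ;;
  call .arg .val ;;
  (loop .val fun a => push .copy a ;; if a = some .zero then skip else push .bad none) ;;
  pop .bad fun
    | none => lookupCmd
    | some _ => (loop .bad fun _ => skip) ;; (loop .copy fun _ => skip) ;; discardCmd

theorem exec_discardCmd_loop (l : List Sym) : ∀ S : St, S.hold = l →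
    Exec g t (loop .hold fun _ => pop .nxt fun _ => skip) S
      { S with hold := [], nxt := S.nxt.drop l.length } (3 * l.length + 1) := by
  induction l with
  | nil =>
    rintro ⟨⟩ rfl
    exact Exec.loop_nil rfl
  | cons a l ih =>
    intro S hS
    have h := ih { S with hold := l, nxt := S.nxt.tail } rfl
    simp only [List.drop_tail] at h
    refine (Exec.loop_cons (S := S) (k := .hold) hS Exec.pop_skip h).mono ?_
    simp only [List.length_cons]
    omega

/-- A formula is put on `nxt` before its fate is known; `hold` keeps its length so that it can be
taken off again. -/
theorem exec_discardCmd (S : St) (l : List Sym) (h : S.nxt = S.hold ++ none :: l) :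
    Exec g t discardCmd S { S with hold := [], nxt := l } (3 * S.hold.length + 3) := by
  refine (Exec.seq (exec_discardCmd_loop S.hold S rfl) (n := 2) ?_).mono (by omega)
  rw [h, List.drop_left]
  exact Exec.pop_skip

/-- Popping beyond the end of the table yields `none`, which is the padding of `takeD`: the table
grows on demand. -/
theorem exec_lookupCmd_loop (l : List Sym) : ∀ S : St, S.copy = l →
    Exec g t (loop .copy fun _ => pop .tab fun o => push .aux (o.getD none)) S
      { S with
        copy := []
        tab := S.tab.drop l.length
        aux := (S.tab.takeD l.length none).reverse ++ S.aux } (3 * l.length + 1) := by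
  induction l with
  | nil =>
    rintro ⟨⟩ rfl
    exact Exec.loop_nil rfl
  | cons a l ih =>
    intro S hS
    have h := ih { S with copy := l, tab := S.tab.tail, aux := S.tab.head?.getD none :: S.aux } rfl
    simp only [List.drop_tail] at h
    have h' : Exec g t (pop .tab fun o => push .aux (o.getD none)) { S with copy := l }
        { S with copy := l, tab := S.tab.tail, aux := S.tab.head?.getD none :: S.aux } 2 :=
      Exec.pop (n := 1) (Exec.push rfl)
    simp only [List.length_cons, List.takeD_succ, List.reverse_cons, List.append_assoc]
    exact (Exec.loop_cons (S := S) (k := .copy) hS h' h).mono (by omega)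

theorem exec_lookupCmd (S : St) (l : List Sym) (h : S.nxt = S.hold ++ none :: l)
    (ha : S.aux = []) :
    Exec g t lookupCmd S
      { S with
        copy := []
        hold := []
        tab := mark S.copy.length S.tab
        nxt := if S.tab[S.copy.length]? = some (some .one) then l else S.nxt }
      (5 * S.copy.length + 3 * S.hold.length + 10) := by
  have hhead : (S.tab.drop S.copy.length).head? = S.tab[S.copy.length]? := List.head?_drop ..
  refine (Exec.seq (exec_lookupCmd_loop S.copy S rfl) (Exec.pop (Exec.seq (Exec.push rfl)
    (Exec.seq (Exec.move (by decide) rfl (S' := { S with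
        copy := []
        aux := []
        tab := mark S.copy.length S.tab }) ?_) (n := 3 * S.hold.length + 3) ?_)))).mono ?_
  · simp [mark, St.set, St.get, ha]
  · simp only [St.get, hhead]
    split_ifs with h'
    · exact exec_discardCmd { S with copy := [], aux := [], tab := mark S.copy.length S.tab } l h
        |> fun h => by simpa [ha] using h
    · refine (Exec.clear rfl ?_).mono ?_
      · simp [St.set, ha]
      · simp only [St.get]
        omega
  · simp only [St.get, St.set, ha, List.append_nil, List.length_reverse, List.takeD_length]
    omega

theorem exec_considerCmd_load (l : List Sym) : ∀ S : St, S.inst₁ = l →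
    Exec g t (loop .inst₁ fun a => push .arg a ;; push .nxt a ;; push .hold a) S
      { S with
        inst₁ := []
        arg := l.reverse ++ S.arg
        nxt := l.reverse ++ S.nxt
        hold := l.reverse ++ S.hold } (4 * l.length + 1) := by
  induction l with
  | nil =>
    rintro ⟨⟩ rfl
    exact Exec.loop_nil rfl
  | cons a l ih =>
    intro S hS
    have h := ih { S with inst₁ := l, arg := a :: S.arg, nxt := a :: S.nxt, hold := a :: S.hold } rfl
    simp only [List.reverse_cons, List.append_assoc, List.length_cons] at h ⊢
    exact (Exec.loop_cons (S := S) (k := .inst₁) hS (Exec.seq (Exec.push rfl) (Exec.seq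
      (Exec.push rfl) (Exec.push rfl))) h).mono (by omega)

theorem exec_considerCmd_check (l : List Sym) : ∀ S : St, S.val = l →
    ∃ b : List Sym, (b = [] ↔ S.bad = [] ∧ ∀ a ∈ l, a = some .zero) ∧
      b.length ≤ S.bad.length + l.length ∧
      Exec g t (loop .val fun a => push .copy a ;; if a = some .zero then skip else push .bad none) S
        { S with val := [], copy := l.reverse ++ S.copy, bad := b } (3 * l.length + 1) := by
  induction l with
  | nil =>
    rintro ⟨⟩ rfl
    exact ⟨_, by simp, by simp, Exec.loop_nil rfl⟩
  | cons a l ih =>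
    intro S hS
    obtain ⟨b, hb, hlen, h⟩ := ih { S with
      val := l
      copy := a :: S.copy
      bad := if a = some .zero then S.bad else none :: S.bad } rfl
    refine ⟨b, ?_, ?_, ?_⟩
    · rw [hb, List.forall_mem_cons]
      split_ifs with h' <;> simp [h']
    · simp only [List.length_cons]
      refine hlen.trans ?_
      dsimp only
      split_ifs
      · omega
      · simp only [List.length_cons]
        omega
    simp only [List.reverse_cons, List.append_assoc, List.length_cons] at h ⊢
    refine (Exec.loop_cons (S := S) (k := .val) hS (Exec.seq (Exec.push rfl) (m := 1) (n := 1) ?_)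
      h).mono (by omega)
    split_ifs
    · exact Exec.skip
    · exact Exec.push rfl

/-- Loading `arg` reverses the formula and the call reverses it back, so the reduction sees it in
reading order. The image on `copy` then serves as a unary index into the table. -/
theorem exec_considerCmd (S : St) (s : List Letter) (ts : List (List Letter))
    (hs : S.inst₁ = s.map some) (hn : S.nxt = stackOf ts) (harg : S.arg = []) (hval : S.val = [])
    (hh : S.hold = []) (hc : S.copy = []) (ha : S.aux = []) (hb : S.bad = []) :
    Exec g t considerCmd S
      { S with
        inst₁ := []
        nxt := stackOf (consider g s (S.tab, ts)).2
        tab := (consider g s (S.tab, ts)).1 }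
      (t s.length + 20 * (s.length + (g s).length) + 30) := by
  obtain ⟨cur, nxt, cnt, pend, name, named, copy, aux, bad, inst₁, inst₀, arg, val, hold, tab, args,
    res⟩ := S
  dsimp only at hs hn harg hval hh hc ha hb ⊢
  subst hs hn harg hval hh hc ha hb
  have hst : stackOf (s :: ts) = (s.map some).reverse ++ none :: stackOf ts := by
    simp [stackOf]
  obtain ⟨b, hb, hlen, h₁⟩ := exec_considerCmd_check (g := g) (t := t)
    ((g s).map some).reverse ⟨cur, stackOf (s :: ts), cnt, pend, name, named, [], [], [], [],
      inst₀, [], ((g s).map some).reverse, (s.map some).reverse, tab, args, res⟩ rfl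
  have hb' : b = [] ↔ ∀ a ∈ g s, a = .zero := by simp [hb]
  refine (Exec.seq (Exec.push rfl) (Exec.seq (exec_considerCmd_load (s.map some)
    ⟨cur, none :: stackOf ts, cnt, pend, name, named, [], [], [], s.map some, inst₀, [], [], [], tab,
      args, res⟩ rfl) (Exec.seq (Exec.call (s := s) (S' := ⟨cur, stackOf (s :: ts), cnt, pend, name,
      named, [], [], [], [], inst₀, [], ((g s).map some).reverse, (s.map some).reverse, tab, args,
      res⟩) ?_ ?_) (Exec.seq h₁ (n := 10 * (s.length + (g s).length) + 12) ?_)))).mono ?_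
  · simp [St.get]
  · simp [St.get, St.set, hst]
  · rw [List.reverse_reverse, List.append_nil]
    by_cases h : ∀ a ∈ g s, a = .zero
    · obtain rfl := hb'.2 h
      have h₂ := exec_lookupCmd (g := g) (t := t) ⟨cur, stackOf (s :: ts), cnt, pend, name, named,
        (g s).map some, [], [], [], inst₀, [], [], (s.map some).reverse, tab, args, res⟩
        (stackOf ts) hst rfl
      simp only [List.length_map, List.length_reverse] at h₂
      rw [consider, if_pos h, apply_ite stackOf]
      exact (Exec.pop_nil rfl h₂).mono (by omega)
    · rcases b with _ | ⟨a, b⟩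
      · exact absurd (hb'.1 rfl) h
      rw [consider, if_neg h]
      have h₂ := exec_discardCmd (g := g) (t := t) ⟨cur, stackOf (s :: ts), cnt, pend, name, named,
        [], [], [], [], inst₀, [], [], (s.map some).reverse, tab, args, res⟩ (stackOf ts) hst
      refine (Exec.pop_cons rfl (Exec.seq (Exec.clear rfl rfl) (Exec.seq (Exec.clear rfl rfl)
        h₂))).mono ?_
      simp only [St.get, St.set, List.length_map, List.length_reverse, List.length_cons,
        List.length_nil] at hlen ⊢
      omega
  · simp only [List.length_reverse, List.length_map]
    omega

/-! ### One round -/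

/-- The stacks between formulas. -/
def idle (cur nxt cnt tab res : List Sym) : St :=
  { St.empty with cur := cur, nxt := nxt, cnt := cnt, tab := tab, res := res }

/-- Process the end of a formula. -/
def endCmd : Cmd Reg Sym :=
  (loop .pend fun _ => skip) ;; (loop .name fun _ => skip) ;; (loop .named fun _ => skip) ;;
  considerCmd ;;
  (loop .inst₀ fun a => push .copy a) ;; (loop .copy fun a => push .inst₁ a) ;;
  considerCmd

/-- Process a list of formulas. -/
def expandCmd : Cmd Reg Sym :=
  loop .cur fun
    | none => endCmd
    | some a => letterCmd a

/-- Replace a list of formulas by their pruned instances. -/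
def roundCmd : Cmd Reg Sym :=
  expandCmd ;; (loop .tab fun _ => skip) ;; (loop .nxt fun a => push .copy a) ;;
  loop .copy fun a => push .cur a

/-- The instances of a formula, pruned. -/
def expand (g : List Letter → List Letter) (p : List Sym × List (List Letter)) (s : List Letter) :
    List Sym × List (List Letter) :=
  consider g (substLast false s) (consider g (substLast true s) p)

/-- The second instance is moved twice so that it reaches `inst₁` in reading order and the same
program can treat it. The table filled by the first instance is kept. -/
theorem exec_endCmd (cur cnt res : List Sym) (p : List Sym × List (List Letter))
    (s : List Letter) {n m T : ℕ} (hs : s.length ≤ n) (hg : ∀ u, u.length ≤ n → (g u).length ≤ m)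
    (ht : ∀ k ≤ n, t k ≤ T) :
    Exec g t endCmd (scanned (idle cur (stackOf p.2) cnt p.1 res) s)
      (idle cur (stackOf (expand g p s).2) cnt (expand g p s).1 res)
      (2 * T + 60 * (n + m) + 100) := by
  have hd := (length_digits_le s).trans hs
  have hw := (length_lastVar_le s).trans hs
  have h₁ := (length_substLast_le true s).trans hs
  have h₀ := (length_substLast_le false s).trans hs
  have hnamed : (if (lastVar s).isSome then [none] else [] : List Sym).length ≤ 1 := by
    split_ifs <;> simp
  have e₁ := exec_considerCmd (g := g) (t := t) { idle cur (stackOf p.2) cnt p.1 res with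
    inst₁ := (substLast true s).map some, inst₀ := (substLast false s).map some }
    (substLast true s) p.2 rfl rfl rfl rfl rfl rfl rfl rfl
  have e₀ := exec_considerCmd (g := g) (t := t) { idle cur
      (stackOf (consider g (substLast true s) p).2) cnt (consider g (substLast true s) p).1 res with
    inst₁ := (substLast false s).map some }
    (substLast false s) (consider g (substLast true s) p).2 rfl rfl rfl rfl rfl rfl rfl rfl
  refine (Exec.seq (Exec.clear rfl rfl) (Exec.seq (Exec.clear rfl rfl) (Exec.seq
    (Exec.clear rfl rfl) (Exec.seq e₁ (Exec.seq (Exec.move (by decide) rfl rfl) (Exec.seq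
    (Exec.move (by decide) rfl ?_) e₀)))))).mono ?_
  · simp [St.set, St.get, idle, St.empty]
  · have := hg _ h₁
    have := hg _ h₀
    have := ht _ h₁
    have := ht _ h₀
    simp only [St.get, St.set, scanned, idle, St.empty, List.length_map, List.length_append,
      List.length_reverse, List.length_nil]
    omega

/-- Here `v` has been read and `u` is still on the stack, last letter first. Each letter costs
linear time, as a name may have to be compared, so a formula costs quadratic time. -/
theorem exec_expandCmd_letters {S' : St} {k : ℕ} (u : List Letter) : ∀ (v : List Letter)
    (rest nxt cnt tab res : List Sym),
    Exec g t expandCmd (scanned (idle rest nxt cnt tab res) (u.reverse ++ v)) S' k →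
    Exec g t expandCmd (scanned (idle (u.map some ++ rest) nxt cnt tab res) v) S'
      (u.length * (50 * (u.length + v.length) + 51) + k) := by
  induction u with
  | nil =>
    intro v rest nxt cnt tab res h
    exact h.mono (by simp)
  | cons a u ih =>
    intro v rest nxt cnt tab res h
    have h₁ := ih (a :: v) rest nxt cnt tab res (by simpa using h)
    have h₂ := exec_letterCmd (g := g) (t := t)
      (idle (u.map some ++ rest) nxt cnt tab res) v rfl rfl rfl a
    refine (Exec.loop_cons rfl h₂ h₁).mono ?_
    simp only [List.length_cons]
    nlinarith

theorem exec_expandCmd (cnt res : List Sym) {n m T : ℕ}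
    (hg : ∀ u, u.length ≤ n → (g u).length ≤ m) (ht : ∀ k ≤ n, t k ≤ T)
    (ts : List (List Letter)) : ∀ p : List Sym × List (List Letter), (∀ s ∈ ts, s.length ≤ n) →
    Exec g t expandCmd (idle (stackOf ts) (stackOf p.2) cnt p.1 res)
      (idle [] (stackOf (ts.foldl (expand g) p).2) cnt (ts.foldl (expand g) p).1 res)
      (ts.length * (50 * n * n + 2 * T + 111 * (n + m) + 101) + 1) := by
  induction ts with
  | nil =>
    intro p _
    exact (Exec.loop_nil rfl).mono (by simp)
  | cons s ts ih =>
    intro p h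
    rw [List.forall_mem_cons] at h
    have h₁ : Exec g t expandCmd
        (scanned (idle (none :: stackOf ts) (stackOf p.2) cnt p.1 res) s) _ _ :=
      Exec.loop_cons rfl (exec_endCmd (stackOf ts) cnt res p s h.1 hg ht) (ih (expand g p s) h.2)
    have h₂ := exec_expandCmd_letters s.reverse [] (none :: stackOf ts) (stackOf p.2) cnt p.1 res
      (by simpa using h₁)
    have hst : stackOf (s :: ts) = s.reverse.map some ++ none :: stackOf ts := by
      simp [stackOf]
    rw [hst]
    refine Exec.mono h₂ ?_
    simp only [List.length_reverse, List.length_nil, List.length_cons]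
    have := Nat.mul_le_mul h.1 (Nat.mul_le_mul_left 50 h.1)
    have := h.1
    nlinarith

/-- One round on lists of formulas. -/
def round (g : List Letter → List Letter) (ts : List (List Letter)) : List (List Letter) :=
  (ts.foldl (expand g) ([], [])).2

/-- The table is cleared at the end because its marks refer to the list just built, whose members
will be replaced by their instances in the next round. -/
theorem exec_roundCmd (cnt res : List Sym) {n m T : ℕ}
    (hg : ∀ u, u.length ≤ n → (g u).length ≤ m) (ht : ∀ k ≤ n, t k ≤ T)
    (ts : List (List Letter)) (hts : ∀ s ∈ ts, s.length ≤ n) :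
    Exec g t roundCmd (idle (stackOf ts) [] cnt [] res) (idle (stackOf (round g ts)) [] cnt [] res)
      (ts.length * (50 * n * n + 2 * T + 111 * (n + m) + 101) +
        2 * (ts.foldl (expand g) ([], [])).1.length + 4 * (stackOf (round g ts)).length + 4) := by
  refine (Exec.seq (exec_expandCmd cnt res hg ht ts ([], []) hts) (Exec.seq (Exec.clear rfl rfl)
    (Exec.seq (Exec.move (by decide) rfl rfl) (Exec.move (by decide) rfl ?_)))).mono ?_
  · simp [St.set, St.get, idle, round, St.empty]
  · simp only [St.get, St.set, idle, St.empty, round, List.length_append, List.length_reverse,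
      List.length_nil]
    omega

end Prune

/-! ### Correctness of pruning -/

theorem mark_succ (n : ℕ) (l : List Sym) :
    mark (n + 1) l = l.head?.getD none :: mark n l.tail := by
  cases l <;> simp [mark]

theorem getElem?_mark_self (n : ℕ) (l : List Sym) : (mark n l)[n]? = some (some .one) := by
  induction n generalizing l with
  | zero => simp [mark]
  | succ n ih => rw [mark_succ, List.getElem?_cons_succ, ih]

theorem getElem?_mark_of_ne {k n : ℕ} (h : k ≠ n) (l : List Sym) :
    (mark n l)[k]? = some (some .one) ↔ l[k]? = some (some .one) := by
  induction n generalizing l k with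
  | zero =>
    obtain ⟨k, rfl⟩ := Nat.exists_eq_succ_of_ne_zero h
    cases l <;> simp [mark]
  | succ n ih =>
    rw [mark_succ]
    rcases k with _ | k
    · cases l <;> simp
    · rw [List.getElem?_cons_succ, ih (by omega)]
      cases l <;> simp

theorem length_mark_le {n m : ℕ} {l : List Sym} (hn : n ≤ m) (hl : l.length ≤ m + 1) :
    (mark n l).length ≤ m + 1 := by
  simp only [mark, List.length_append, List.takeD_length, List.length_cons, List.length_tail,
    List.length_drop]
  omega

/-- The table consists of the marks of the values of the formulas in the list. -/
structure IsTable (g : List Letter → List Letter) (m : ℕ) (p : List Sym × List (List Letter)) :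
    Prop where
  length_le : p.1.length ≤ m + 1
  zero_of_mem : ∀ s ∈ p.2, ∀ a ∈ g s, a = .zero
  marked_iff : ∀ k : ℕ, p.1[k]? = some (some .one) ↔ ∃ s ∈ p.2, (g s).length = k
  nodup : (p.2.map fun s => (g s).length).Nodup

section

variable {g : List Letter → List Letter} {m n : ℕ} {p : List Sym × List (List Letter)}

theorem IsTable.nil : IsTable g m ([], []) := ⟨by simp, by simp, by simp, by simp⟩

/-- Pigeonhole: the images of the listed formulas have distinct lengths, and each length is a
position in the table. -/
theorem IsTable.length_snd_le (h : IsTable g m p) : p.2.length ≤ m + 1 := by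
  have h₁ : (p.2.map fun s => (g s).length).toFinset ⊆ Finset.range (m + 1) := by
    intro k hk
    rw [List.mem_toFinset, List.mem_map] at hk
    obtain ⟨hk, -⟩ := List.getElem?_eq_some_iff.1 ((h.marked_iff k).2 hk)
    exact Finset.mem_range.2 (hk.trans_le h.length_le)
  simpa [List.toFinset_card_of_nodup h.nodup] using Finset.card_le_card h₁

theorem IsTable.consider (h : IsTable g m p) {s : List Letter} (hs : (g s).length ≤ m) :
    IsTable g m (consider g s p) := by
  rw [PropSAT.consider]
  split_ifs with h₁ h₂
  · refine ⟨length_mark_le hs h.length_le, h.zero_of_mem, fun k => ?_, h.nodup⟩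
    by_cases hk : k = (g s).length
    · rw [hk, getElem?_mark_self, ← h.marked_iff, h₂]
    · rw [getElem?_mark_of_ne hk, h.marked_iff]
  · refine ⟨length_mark_le hs h.length_le, List.forall_mem_cons.2 ⟨h₁, h.zero_of_mem⟩,
      fun k => ?_, ?_⟩
    · by_cases hk : k = (g s).length
      · rw [hk, getElem?_mark_self]
        simp
      · rw [getElem?_mark_of_ne hk, h.marked_iff]
        simp [Ne.symm hk]
    · rw [List.map_cons, List.nodup_cons]
      refine ⟨fun h' => h₂ ((h.marked_iff _).2 (List.mem_map.1 h')), h.nodup⟩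
  · exact h

theorem subset_consider (s : List Letter) : p.2 ⊆ (consider g s p).2 := by
  rw [consider]
  split_ifs
  · exact List.Subset.refl _
  · exact List.subset_cons_self _ _
  · exact List.Subset.refl _

theorem mem_consider {s u : List Letter} (h : u ∈ (consider g s p).2) : u = s ∨ u ∈ p.2 := by
  rw [consider] at h
  split_ifs at h
  · exact .inr h
  · exact List.mem_cons.1 h
  · exact .inr h

/-- The image of a member of `A` lies in `T`, so it is a string of zeros and passes the first test.
If its length is already marked, some listed `u` has an image of zeros of that length, that is, the
same image, and `u` is in `A` as well. -/
theorem exists_mem_consider {A T : Language Letter} (hT : IsTally T)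
    (hg : ∀ s, s ∈ A ↔ g s ∈ T) (h : IsTable g m p) {s : List Letter} (hs : s ∈ A) :
    ∃ u ∈ (consider g s p).2, u ∈ A := by
  have hz : ∀ a ∈ g s, a = .zero := by
    obtain ⟨k, hk⟩ := hT _ ((hg s).1 hs)
    rw [hk]
    exact fun a ha => List.eq_of_mem_replicate ha
  rw [consider, if_pos hz]
  dsimp only
  split_ifs with h₁
  · obtain ⟨u, hu, hlen⟩ := (h.marked_iff _).1 h₁
    refine ⟨u, hu, (hg u).2 ?_⟩
    rw [List.eq_replicate_length.2 (h.zero_of_mem u hu), hlen, ← List.eq_replicate_length.2 hz]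
    exact (hg s).1 hs
  · exact ⟨s, List.mem_cons_self, hs⟩

theorem IsTable.foldl_expand (hg : ∀ u, u.length ≤ n → (g u).length ≤ m)
    {ts : List (List Letter)} (hts : ∀ s ∈ ts, s.length ≤ n) (h : IsTable g m p) :
    IsTable g m (ts.foldl (expand g) p) := by
  induction ts generalizing p with
  | nil => exact h
  | cons s ts ih =>
    rw [List.forall_mem_cons] at hts
    exact ih hts.2 ((h.consider (hg _ ((length_substLast_le _ _).trans hts.1))).consider
      (hg _ ((length_substLast_le _ _).trans hts.1)))

theorem mem_foldl_expand {ts : List (List Letter)} {u : List Letter}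
    (h : u ∈ (ts.foldl (expand g) p).2) : u ∈ p.2 ∨ ∃ s ∈ ts, ∃ b, u = substLast b s := by
  induction ts generalizing p with
  | nil => exact .inl h
  | cons s ts ih =>
    rcases ih h with h | ⟨s', hs', b, hb⟩
    · rcases mem_consider h with h | h
      · exact .inr ⟨s, List.mem_cons_self, _, h⟩
      · rcases mem_consider h with h | h
        · exact .inr ⟨s, List.mem_cons_self, _, h⟩
        · exact .inl h
    · exact .inr ⟨s', List.mem_cons_of_mem _ hs', b, hb⟩

theorem subset_foldl_expand (ts : List (List Letter)) : p.2 ⊆ (ts.foldl (expand g) p).2 := by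
  induction ts generalizing p with
  | nil => exact List.Subset.refl _
  | cons s ts ih => exact List.Subset.trans (List.Subset.trans (subset_consider _) (subset_consider _)) ih

theorem exists_mem_foldl_expand {T : Language Letter} (hT : IsTally T)
    (hgT : ∀ s, s ∈ SAT ↔ g s ∈ T) (hg : ∀ u, u.length ≤ n → (g u).length ≤ m)
    {ts : List (List Letter)} (hts : ∀ s ∈ ts, s.length ≤ n) (h : IsTable g m p)
    {s : List Letter} (hs : s ∈ ts) (hsat : s ∈ SAT) :
    ∃ u ∈ (ts.foldl (expand g) p).2, u ∈ SAT := by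
  induction ts generalizing p with
  | nil => simp at hs
  | cons s' ts ih =>
    rw [List.forall_mem_cons] at hts
    have h₁ := h.consider (hg _ ((length_substLast_le true s').trans hts.1))
    have h₀ := h₁.consider (hg _ ((length_substLast_le false s').trans hts.1))
    rcases List.mem_cons.1 hs with rfl | hs
    -- One of the two instances is satisfiable. It or a substitute enters the list, and nothing
    -- leaves the list during a round.
    · rcases (mem_SAT_iff_substLast s).1 hsat with hsat | hsat
      · obtain ⟨u, hu, hu'⟩ := exists_mem_consider hT hgT h hsat
        exact ⟨u, subset_foldl_expand ts (subset_consider _ hu), hu'⟩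
      · obtain ⟨u, hu, hu'⟩ := exists_mem_consider hT hgT h₁ hsat
        exact ⟨u, subset_foldl_expand ts hu, hu'⟩
    · exact ih hts.2 h₀ hs

/-- Only existence of a satisfiable member is preserved: instances of unsatisfiable formulas are
unsatisfiable, and pruning never loses the last satisfiable one. -/
theorem exists_mem_round_iff {T : Language Letter} (hT : IsTally T)
    (hgT : ∀ s, s ∈ SAT ↔ g s ∈ T) (hg : ∀ u, u.length ≤ n → (g u).length ≤ m)
    {ts : List (List Letter)} (hts : ∀ s ∈ ts, s.length ≤ n) :
    (∃ u ∈ round g ts, u ∈ SAT) ↔ ∃ s ∈ ts, s ∈ SAT := by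
  constructor
  · rintro ⟨u, hu, hsat⟩
    rcases mem_foldl_expand hu with h | ⟨s, hs, b, rfl⟩
    · simp at h
    · refine ⟨s, hs, (mem_SAT_iff_substLast s).2 ?_⟩
      cases b
      · exact .inr hsat
      · exact .inl hsat
  · rintro ⟨s, hs, hsat⟩
    exact exists_mem_foldl_expand hT hgT hg hts .nil hs hsat

theorem length_le_of_mem_round {ts : List (List Letter)} (hts : ∀ s ∈ ts, s.length ≤ n) :
    ∀ u ∈ round g ts, u.length ≤ n := by
  intro u hu
  rcases mem_foldl_expand hu with h | ⟨s, hs, b, rfl⟩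
  · simp at h
  · exact (length_substLast_le b s).trans (hts s hs)

theorem count_le_of_mem_round {ts : List (List Letter)} {c : ℕ}
    (hts : ∀ s ∈ ts, s.count .x ≤ c) : ∀ u ∈ round g ts, u.count .x ≤ c - 1 := by
  intro u hu
  rcases mem_foldl_expand hu with h | ⟨s, hs, b, rfl⟩
  · simp at h
  · exact (count_substLast_le b s).trans (Nat.sub_le_sub_right (hts s hs) 1)

theorem length_round_le (hg : ∀ u, u.length ≤ n → (g u).length ≤ m)
    {ts : List (List Letter)} (hts : ∀ s ∈ ts, s.length ≤ n) : (round g ts).length ≤ m + 1 :=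
  (IsTable.foldl_expand hg hts .nil).length_snd_le

theorem length_stackOf_le {ts : List (List Letter)} (hts : ∀ s ∈ ts, s.length ≤ n) :
    (stackOf ts).length ≤ ts.length * (n + 1) := by
  induction ts with
  | nil => simp [stackOf]
  | cons s ts ih =>
    rw [List.forall_mem_cons] at hts
    have := ih hts.2
    have := hts.1
    simp only [stackOf, List.flatMap_cons, List.length_append, List.length_map, List.length_reverse,
      List.length_cons, List.length_nil] at *
    nlinarith

end

/-! ### Evaluation of variable-free formulas -/

/-- A truth value as a stack symbol. -/
def bit (b : Bool) : Sym := some (.ofBit b)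

/-- The stacks of arguments and of errors after evaluating a letter. -/
def evalStep : Letter → List Sym × List Sym → List Sym × List Sym
  | .verum, (l, e) => (bit true :: l, e)
  | .falsum, (l, e) => (bit false :: l, e)
  | .neg, (b :: l, e) => (bit (b ≠ bit true) :: l, e)
  | .conj, (b :: c :: l, e) => (bit (b = bit true ∧ c = bit true) :: l, e)
  | .disj, (b :: c :: l, e) => (bit (b = bit true ∨ c = bit true) :: l, e)
  | _, (l, e) => (l.drop 2, none :: e)

/-- The stacks `p` of arguments and of errors represent the value of the string `s`. -/
def Represents (s : List Letter) (p : List Sym × List Sym) : Prop :=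
  p.1.length + p.2.length ≤ s.length ∧
    (∀ l, evalClosed s = some l → p = (l.map bit, [])) ∧ (evalClosed s = none → p.2 ≠ [])

theorem Represents.cons {s : List Letter} {p : List Sym × List Sym} (h : Represents s p)
    (a : Letter) : Represents (a :: s) (evalStep a p) := by
  obtain ⟨l, e⟩ := p
  obtain ⟨hlen, hsome, hnone⟩ := h
  simp only at hlen hnone
  rcases hs : evalClosed s with _ | k
  · have he := hnone hs
    refine ⟨?_, ?_, fun _ => ?_⟩
    · rcases a <;> rcases l with _ | ⟨b, _ | ⟨c, l⟩⟩ <;>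
        simp only [evalStep, List.length_cons, List.length_nil, List.drop] at hlen ⊢ <;> omega
    · simp [evalClosed, hs]
    · rcases a <;> rcases l with _ | ⟨b, _ | ⟨c, l⟩⟩ <;> simp [evalStep, he]
  · obtain ⟨rfl, rfl⟩ := Prod.mk.inj (hsome k hs)
    have hbit : ∀ b, bit b = bit true ↔ b = true := by decide
    refine ⟨?_, ?_, ?_⟩
    · rcases a <;> rcases k with _ | ⟨b, _ | ⟨c, k⟩⟩ <;>
        simp only [evalStep, List.map_cons, List.map_nil, List.length_cons, List.length_nil,
          List.drop] at hlen ⊢ <;> omega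
    · intro k' hk'
      simp only [evalClosed, hs, Option.bind_some] at hk'
      rcases a <;> rcases k with _ | ⟨b, _ | ⟨c, k⟩⟩ <;>
        simp only [Letter.op, Option.some.injEq, reduceCtorEq] at hk' <;>
        subst hk' <;> simp [evalStep, hbit]
    · intro hk'
      simp only [evalClosed, hs, Option.bind_some] at hk'
      rcases a <;> rcases k with _ | ⟨b, _ | ⟨c, k⟩⟩ <;> simp_all [evalStep, Letter.op]

section Decide

variable {g : List Letter → List Letter} {t : ℕ → ℕ}

open Cmd

/-- The program for `evalStep`. -/
def evalCmd : Letter → Cmd Reg Sym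
  | .verum => push .args (bit true)
  | .falsum => push .args (bit false)
  | .neg => pop .args fun
    | none => push .bad none
    | some b => push .args (bit (b ≠ bit true))
  | .conj => pop .args fun
    | none => push .bad none
    | some b => pop .args fun
      | none => push .bad none
      | some c => push .args (bit (b = bit true ∧ c = bit true))
  | .disj => pop .args fun
    | none => push .bad none
    | some b => pop .args fun
      | none => push .bad none
      | some c => push .args (bit (b = bit true ∨ c = bit true))
  | _ => (pop .args fun _ => skip) ;; (pop .args fun _ => skip) ;; push .bad none

theorem exec_evalCmd (S : St) (a : Letter) (p : List Sym × List Sym) :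
    Exec g t (evalCmd a) { S with args := p.1, bad := p.2 }
      { S with args := (evalStep a p).1, bad := (evalStep a p).2 } 5 := by
  obtain ⟨l, e⟩ := p
  have hdrop : Exec g t ((pop .args fun _ => skip) ;; (pop .args fun _ => skip) ;; push .bad none)
      { S with args := l, bad := e } { S with args := l.drop 2, bad := none :: e } 5 :=
    Exec.seq Exec.pop_skip (Exec.seq Exec.pop_skip (Exec.push (by
      rcases l with _ | ⟨_, _ | _⟩ <;> rfl)))
  rcases a
  case zero | one | x => exact hdrop
  case verum | falsum => exact (Exec.push rfl).mono (by omega)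
  case neg =>
    rcases l with _ | ⟨b, l⟩
    · exact (Exec.pop_nil rfl (Exec.push rfl)).mono (by omega)
    · exact (Exec.pop_cons rfl (Exec.push rfl)).mono (by omega)
  case conj | disj =>
    rcases l with _ | ⟨b, _ | ⟨c, l⟩⟩
    · exact (Exec.pop_nil rfl (Exec.push rfl)).mono (by omega)
    · exact (Exec.pop_cons rfl (Exec.pop_nil rfl (Exec.push rfl))).mono (by omega)
    · exact (Exec.pop_cons rfl (Exec.pop_cons rfl (Exec.push rfl))).mono (by omega)

/-- Record whether the value of a formula is True. -/
def checkCmd : Cmd Reg Sym :=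
  pop .args fun
    | none => loop .bad fun _ => skip
    | some b => pop .args fun
      | some _ => (loop .args fun _ => skip) ;; loop .bad fun _ => skip
      | none => pop .bad fun
        | some _ => loop .bad fun _ => skip
        | none => if b = bit true then (pop .res fun _ => skip) ;; push .res none else skip

open Classical in
/-- A proposition as the content of a stack. -/
noncomputable def flag (q : Prop) : List Sym := if q then [none] else []

/-- By `Represents`, the value is `[true]` exactly if there is a single argument, it is the bit
True, and no error was recorded. -/
theorem exec_checkCmd (cur : List Sym) (q : Prop) {s : List Letter} {p : List Sym × List Sym}
    (h : Represents s p) :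
    Exec g t checkCmd { idle cur [] [] [] (flag q) with args := p.1, bad := p.2 }
      (idle cur [] [] [] (flag (q ∨ evalClosed s = some [true]))) (2 * s.length + 10) := by
  obtain ⟨l, e⟩ := p
  obtain ⟨hlen, hsome, hnone⟩ := h
  simp only at hlen hnone ⊢
  have hfalse : evalClosed s ≠ some [true] →
      flag (q ∨ evalClosed s = some [true]) = flag q := by
    intro h; simp [h]
  rcases l with _ | ⟨b, _ | ⟨c, l⟩⟩
  · rw [hfalse fun h' => by simpa using hsome _ h']
    refine (Exec.pop_nil rfl (Exec.clear rfl rfl)).mono ?_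
    simp only [St.get, List.length_nil] at hlen ⊢
    omega
  · rcases e with _ | ⟨a, e⟩
    · rcases hs : evalClosed s with _ | k
      · exact absurd rfl (hnone hs)
      obtain ⟨hk, -⟩ := Prod.mk.inj (hsome k hs)
      have hb : some k = some [true] ↔ b = bit true := by
        rcases k with _ | ⟨x, _ | ⟨y, k⟩⟩
        · simp at hk
        · simp only [List.map_cons, List.map_nil, List.cons.injEq, and_true] at hk
          subst hk
          cases x <;> decide
        · simp at hk
      refine (Exec.pop_cons rfl (Exec.pop_nil rfl (Exec.pop_nil rfl (n := 3) ?_))).mono (by omega)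
      rw [hb]
      by_cases hb' : b = bit true
      · rw [if_pos hb']
        -- Popping before pushing keeps at most one symbol on `res`, as the output stage of the
        -- machine requires.
        refine Exec.seq Exec.pop_skip (Exec.push ?_)
        by_cases hq : q <;> simp [flag, hb', hq, St.set, St.get, idle, St.empty]
      · rw [if_neg hb']
        simp only [hb', or_false]
        exact Exec.skip.mono (by omega)
    · rw [hfalse fun h' => by simpa using hsome _ h']
      refine (Exec.pop_cons rfl (Exec.pop_nil rfl (Exec.pop_cons rfl (Exec.clear rfl rfl)))).mono ?_
      simp only [St.get, St.set, List.length_cons, List.length_nil] at hlen ⊢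
      omega
  · rw [hfalse fun h' => by simpa using hsome _ h']
    refine (Exec.pop_cons rfl (Exec.pop_cons rfl (Exec.seq (Exec.clear rfl rfl)
      (Exec.clear rfl rfl)))).mono ?_
    simp only [St.get, St.set, List.length_cons] at hlen ⊢
    omega

/-- Evaluate a list of variable-free formulas. -/
def evalAllCmd : Cmd Reg Sym :=
  loop .cur fun
    | none => checkCmd
    | some a => evalCmd a

theorem exec_evalAllCmd_letters {S' : St} {k : ℕ} (cur res : List Sym) (u : List Letter) :
    ∀ (v : List Letter) (p : List Sym × List Sym), Represents v p →
    (∀ p', Represents (u.reverse ++ v) p' →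
      Exec g t evalAllCmd { idle cur [] [] [] res with args := p'.1, bad := p'.2 } S' k) →
    Exec g t evalAllCmd { idle (u.map some ++ cur) [] [] [] res with args := p.1, bad := p.2 } S'
      (6 * u.length + k) := by
  induction u with
  | nil =>
    intro v p hp h
    exact (h p hp).mono (by simp)
  | cons a u ih =>
    intro v p hp h
    have h₁ := ih (a :: v) _ (hp.cons a) (by simpa using h)
    refine (Exec.loop_cons rfl (exec_evalCmd (idle (u.map some ++ cur) [] [] [] res) a p)
      h₁).mono ?_
    simp only [List.length_cons]
    omega

theorem exec_evalAllCmd {n : ℕ} (ts : List (List Letter)) (hts : ∀ s ∈ ts, s.length ≤ n) :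
    ∀ q : Prop, Exec g t evalAllCmd (idle (stackOf ts) [] [] [] (flag q))
      (idle [] [] [] [] (flag (q ∨ ∃ s ∈ ts, evalClosed s = some [true])))
      (ts.length * (8 * n + 11) + 1) := by
  induction ts with
  | nil =>
    intro q
    simp only [List.not_mem_nil, false_and, exists_false, or_false]
    exact (Exec.loop_nil rfl).mono (by simp)
  | cons s ts ih =>
    intro q
    rw [List.forall_mem_cons] at hts
    have hst : stackOf (s :: ts) = s.reverse.map some ++ none :: stackOf ts := by
      simp [stackOf]
    have h := exec_evalAllCmd_letters (g := g) (t := t) (none :: stackOf ts) (flag q) s.reverse []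
      ([], []) ⟨by simp, by simp [evalClosed], by simp [evalClosed]⟩ fun p' hp' =>
        Exec.loop_cons rfl (exec_checkCmd (stackOf ts) q (by simpa using hp')) (ih hts.2 _)
    rw [hst]
    simp only [List.exists_mem_cons_iff, ← or_assoc]
    refine Exec.mono h ?_
    simp only [List.length_reverse, List.length_cons]
    have := hts.1
    nlinarith

/-! ### The decision procedure -/

/-- The decision procedure for SAT. -/
def satCmd : Cmd Reg Sym :=
  (loop .cur fun a => push .copy a ;; push .cnt none) ;;
  push .cur none ;;
  (loop .copy fun a => push .cur a) ;;
  (loop .cnt fun _ => roundCmd) ;;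
  evalAllCmd

theorem exec_satCmd_count (l : List Sym) : ∀ S : St, S.cur = l →
    Exec g t (loop .cur fun a => push .copy a ;; push .cnt none) S
      { S with cur := [], copy := l.reverse ++ S.copy, cnt := List.replicate l.length none ++ S.cnt }
      (3 * l.length + 1) := by
  induction l with
  | nil =>
    rintro ⟨⟩ rfl
    exact Exec.loop_nil rfl
  | cons a l ih =>
    intro S hS
    have h := ih { S with cur := l, copy := a :: S.copy, cnt := none :: S.cnt } rfl
    have e : List.replicate (l.length + 1) none ++ S.cnt =
        List.replicate l.length none ++ none :: S.cnt := by
      rw [List.replicate_succ', List.append_assoc]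
      rfl
    simp only [List.reverse_cons, List.append_assoc, List.length_cons, e]
    exact (Exec.loop_cons (S := S) (k := .cur) hS (Exec.seq (Exec.push rfl) (Exec.push rfl))
      h).mono (by omega)

/-- A bound for the cost of a round on at most `m + 1` formulas of length at most `n`. -/
def roundCost (n m T : ℕ) : ℕ :=
  (m + 1) * (50 * n * n + 2 * T + 111 * (n + m) + 101) + 2 * (m + 1) +
    4 * ((m + 1) * (n + 1)) + 4

theorem exec_satCmd_rounds (res : List Sym) {n m T : ℕ}
    (hg : ∀ u, u.length ≤ n → (g u).length ≤ m) (ht : ∀ k ≤ n, t k ≤ T) (k : ℕ) :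
    ∀ ts : List (List Letter), (∀ s ∈ ts, s.length ≤ n) → ts.length ≤ m + 1 →
      Exec g t (loop .cnt fun _ => roundCmd) (idle (stackOf ts) [] (List.replicate k none) [] res)
        (idle (stackOf ((round g)^[k] ts)) [] [] [] res) (k * (roundCost n m T + 1) + 1) := by
  induction k with
  | zero =>
    intro ts _ _
    exact (Exec.loop_nil rfl).mono (by simp)
  | succ k ih =>
    intro ts hts hlen
    have hr := length_le_of_mem_round (g := g) hts
    have hrl := length_round_le hg hts
    have h₁ := exec_roundCmd (List.replicate k none) res hg ht ts hts
    have h₂ := ih (round g ts) hr hrl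
    rw [iterate_succ_apply]
    refine (Exec.loop_cons rfl (Exec.mono h₁ (n := roundCost n m T) ?_) h₂).mono ?_
    -- The bound `m + 1` on the number of formulas holds before every round: it is assumed for the
    -- first list, and pruning provides it afterwards.
    · have := Nat.mul_le_mul_right (50 * n * n + 2 * T + 111 * (n + m) + 101) hlen
      have := (IsTable.foldl_expand hg hts (.nil (g := g) (m := m))).length_le
      have := (length_stackOf_le hr).trans (Nat.mul_le_mul_right (n + 1) hrl)
      rw [roundCost]
      omega
    · rw [Nat.succ_mul]
      omega

theorem iterate_round_spec {T : Language Letter} (hT : IsTally T)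
    (hgT : ∀ s, s ∈ SAT ↔ g s ∈ T) {n m : ℕ} (hg : ∀ u, u.length ≤ n → (g u).length ≤ m)
    {ts : List (List Letter)} (hts : ∀ s ∈ ts, s.length ≤ n) (hlen : ts.length ≤ m + 1) {c : ℕ}
    (hc : ∀ s ∈ ts, s.count .x ≤ c) (k : ℕ) :
    (∀ s ∈ (round g)^[k] ts, s.length ≤ n) ∧ ((round g)^[k] ts).length ≤ m + 1 ∧
      (∀ s ∈ (round g)^[k] ts, s.count .x ≤ c - k) ∧
      ((∃ s ∈ (round g)^[k] ts, s ∈ SAT) ↔ ∃ s ∈ ts, s ∈ SAT) := by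
  induction k with
  | zero => exact ⟨hts, hlen, hc, Iff.rfl⟩
  | succ k ih =>
    obtain ⟨h₁, -, h₃, h₄⟩ := ih
    rw [iterate_succ_apply']
    exact ⟨length_le_of_mem_round h₁, length_round_le hg h₁,
      by simpa [Nat.sub_sub] using count_le_of_mem_round h₃,
      (exists_mem_round_iff hT hgT hg h₁).trans h₄⟩

theorem exec_satCmd {T : Language Letter} (hT : IsTally T) (hgT : ∀ s, s ∈ SAT ↔ g s ∈ T)
    (s : List Letter) {m M : ℕ} (hg : ∀ u : List Letter, u.length ≤ s.length → (g u).length ≤ m)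
    (ht : ∀ k ≤ s.length, t k ≤ M) :
    Exec g t satCmd (idle (s.reverse.map some) [] [] [] []) (idle [] [] [] [] (flag (s ∈ SAT)))
      (s.length * (roundCost s.length m M + 1) + (m + 1) * (8 * s.length + 11) +
        5 * s.length + 10) := by
  have hs : ∀ u ∈ [s], u.length ≤ s.length := by simp
  have hcount : ∀ u ∈ [s], u.count .x ≤ s.length := by simpa using List.count_le_length
  obtain ⟨h₁, h₂, h₃, h₄⟩ := iterate_round_spec hT hgT hg hs (by simp) hcount s.length
  have h₅ := exec_evalAllCmd (g := g) (t := t) _ h₁ False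
  have hiff : (False ∨ ∃ u ∈ (round g)^[s.length] [s], evalClosed u = some [true]) = (s ∈ SAT) := by
    rw [false_or, eq_iff_iff]
    refine Iff.trans ?_ (h₄.trans (by simp))
    -- A string of length `s.length` has at most that many occurrences of `x`, so none is left after
    -- `s.length` rounds and `evalClosed` decides satisfiability.
    refine exists_congr fun u => and_congr_right fun hu => (mem_SAT_iff_evalClosed ?_).symm
    rw [← List.count_eq_zero]
    simpa using h₃ u hu
  have h₀ := exec_satCmd_rounds (t := t) [] hg ht s.length [s] hs (by simp)
  rw [hiff] at h₅
  have hflag : flag False = [] := by simp [flag]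
  rw [hflag] at h₅
  refine (Exec.seq (exec_satCmd_count (s.reverse.map some) _ rfl) (Exec.seq (Exec.push rfl)
    (Exec.seq (Exec.move (by decide) rfl ?_) (Exec.seq h₀ h₅)))).mono ?_
  · simp [St.set, St.get, idle, St.empty, stackOf]
  · have := Nat.mul_le_mul_right (8 * s.length + 11) h₂
    simp only [St.get, St.set, idle, St.empty, List.length_map, List.length_reverse,
      List.length_append, List.length_nil]
    omega

end Decide

open Classical Polynomial in
/-- SAT is decidable in polynomial time if it reduces to a tally set. -/
theorem SAT_mem_P_of_isTally {T : Language Letter} (hT : IsTally T) (h : PolyTimeReduces SAT T) :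
    SAT ∈ P Letter := by
  obtain ⟨g, ⟨hg⟩, hgT⟩ := h
  obtain ⟨c, hc⟩ := hg.tm.exists_length_output_le
  -- The separator is encoded as the letter `0`, in agreement with `symFun`, to make the call total
  -- on stack symbols.
  set enc : Sym → hg.tm.Γ hg.tm.k₀ := fun b => hg.inputAlphabet.symm (b.getD .zero)
  set dec : hg.tm.Γ hg.tm.k₁ → Sym := fun y => some (hg.outputAlphabet y)
  have hlen : ∀ n (u : List Letter), u.length ≤ n →
      (g u).length ≤ n + c * hg.time.eval n := by
    intro n u hu
    have := hc (hg.outputsFun u)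
    simp only [id, List.length_map] at this
    exact this.trans (Nat.add_le_add hu (Nat.mul_le_mul_left c (hg.time.eval_mono_nat hu)))
  have hcall : ∀ l : List Sym, ∃ out : List (hg.tm.Γ hg.tm.k₁), out.map dec = symFun g l ∧
      Nonempty (Turing.TM2OutputsInTime hg.tm (l.map enc) (some out) (hg.time.eval l.length)) := by
    intro l
    refine ⟨(g (l.map (·.getD .zero))).map hg.outputAlphabet.invFun, ?_, ?_⟩
    · simp [dec, symFun, Function.comp_def]
    · have := hg.outputsFun (l.map (·.getD .zero))
      simp only [id, List.length_map, List.map_map] at this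
      exact ⟨this⟩
  refine ⟨fun s => decide (s ∈ SAT), ?_, fun s => by simp⟩
  -- The bound `hlen` on the length of images as a polynomial; the polynomial below is the cost in
  -- `exec_satCmd` with `roundCost` unfolded.
  let m : ℕ[X] := X + C c * hg.time
  refine Cmd.computable_of_runs enc dec some .cur .res satCmd hcall
    (X * ((m + 1) * (50 * X * X + 2 * hg.time + 111 * (X + m) + 101) + 2 * (m + 1) +
      4 * ((m + 1) * (X + 1)) + 4 + 1) + (m + 1) * (8 * X + 11) + 5 * X + 10) _ none fun s => ?_
  have h := exec_satCmd (t := fun n => hg.time.eval n) hT hgT s (hlen s.length)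
    fun k hk => hg.time.eval_mono_nat hk
  have e : update (fun _ => []) Reg.cur (s.reverse.map some) =
      (idle (s.reverse.map some) [] [] [] []).get := by
    rw [← St.get_empty, ← St.get_set]
    rfl
  have e' : update (fun _ => []) Reg.res (if decide (s ∈ SAT) then [none] else []) =
      (idle [] [] [] [] (flag (s ∈ SAT))).get := by
    rw [← St.get_empty, ← St.get_set]
    simp only [decide_eq_true_eq]
    rfl
  rw [e, e']
  refine Exec.mono h (le_of_eq ?_)
  simp [roundCost, m]

end PropSAT

theorem mainTheorem2
    (h : ∃ T : Language PropSAT.Letter,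
      PropSAT.IsTally T ∧ PropSAT.PolyTimeReduces PropSAT.SAT T) :
    PropSAT.SAT ∈ PropSAT.P PropSAT.Letter := by
  obtain ⟨T, hT, h⟩ := h
  exact PropSAT.SAT_mem_P_of_isTally hT h
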